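/- Let $p\in(0,1)$ and let $S_0=0$, $S_k=X_1+\dots+X_k$, where $X_1,X_2,\dots$ are i.i.d. with $P(X_i=1)=p$ and $P(X_i=-1)=q=1-p$; let $M_k=\max\{S_0,\dots,S_k\}$. Consider the problem of choosing a stopping time $\tau\le N$ of the walk so as to maximize $P(M_N-S_\tau\le 1)$. For $n\ge 1$ let $(n,1)$ be the state in which $n$ steps remain and the walk is exactly one unit below its running maximum; a stopping time $\tau\le n$ of the walk restarted in this state wins with probability $P\bigl(\max(1,M_n)-S_\tau\le 1\bigr)$, and it is called optimal to stop in $(n,1)$ if no stopping time $\tau\le n$ has a larger win probability than $\tau\equiv 0$. Let $p_n$ be the supremum of all $p\in(0,1)$ for which it is optimal to stop in state $(n,1)$. Then for every $n\ge 1$ and $p\in(0,1)$ it is optimal to stop in state $(n,1)$ if and only if $p\le p_n$, and the critical values $p_n$ satisfy: (a) $p_4$ is the smallest term of the sequence $(p_n)_{n\ge1}$, that is, $p_n\ge p_4$ for all $n\ge 1$, where $p_4=0.468989\ldots$, i.e. $0.468989\le p_4<0.468990$; (b) $p_{2n+1}\ge p_{2n+4}$ for every $n\ge 0$; (c) $p_{2n+1}\ge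 p_{2n+6}$ for every $n\ge 3$. -/

import Mathlib

open MeasureTheory ProbabilityTheory unitInterval

namespace BernoulliWalk

/-- The canonical sample space of infinite sequences of coin tosses: `true` is an up-step, `false`
is a down-step. -/
abbrev Path : Type := ℕ → Bool

/-- The law of independent tosses, each of which is an up-step with probability `p` and a down-step
with probability `1 - p`. -/
noncomputable def law (p : I) : Measure Path :=
  Measure.infinitePi fun _ : ℕ => bernoulliMeasure true false p

/-- The size of a step: `+1` for up, `-1` for down. -/
def step (b : Bool) : ℤ := if b then 1 else -1

/-- The random walk `S 0 = 0`, `S n = X 1 + ⋯ + X n`. -/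
def S (n : ℕ) (ω : Path) : ℤ := ∑ i ∈ Finset.range n, step (ω i)

/-- The running maximum `M n = max {S 0, S 1, …, S n}`. -/
def M (n : ℕ) (ω : Path) : ℤ :=
  (Finset.range (n + 1)).sup' Finset.nonempty_range_add_one fun k => S k ω

theorem stronglyMeasurable_S (n : ℕ) : StronglyMeasurable (S n) := by
  have h : Measurable (S n) :=
    Finset.measurable_sum _ fun i _ => (measurable_from_top (f := step)).comp (measurable_pi_apply i)
  exact h.stronglyMeasurable

/-- The natural filtration of the walk `S`. -/
noncomputable def walkFiltration : Filtration ℕ (inferInstance : MeasurableSpace Path) :=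
  Filtration.natural S stronglyMeasurable_S

/-- `τ` is a stopping rule available when `n` steps remain: a stopping time adapted to the walk
and bounded by `n`. -/
def IsStoppingRule (n : ℕ) (τ : Path → ℕ) : Prop :=
  IsStoppingTime walkFiltration (fun ω => (τ ω : WithTop ℕ)) ∧ ∀ ω, τ ω ≤ n

/-- The win probability of the rule `τ` from state `(n, j)`, that is, when `n` steps remain and the
walk is `j` units below its running maximum. The walk is restarted from its current position, so
that the maximum so far is `j` and the maximum at the horizon is `max j (M n)`; the rule wins if it
stops at most one unit below the latter. -/
noncomputable def winProb (p : I) (n j : ℕ) (τ : Path → ℕ) : ℝ :=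
  (law p).real {ω | max (j : ℤ) (M n ω) - S (τ ω) ω ≤ 1}

/-- In state `(n, j)` it is optimal to stop: no stopping rule has a larger win probability
than stopping at once. -/
def OptimalToStop (p : I) (n j : ℕ) : Prop :=
  ∀ τ : Path → ℕ, IsStoppingRule n τ → winProb p n j τ ≤ winProb p n j (fun _ => 0)

/-- The critical value `p_n`: the supremum of all parameters `p ∈ (0, 1)` for which it is optimal
to stop in state `(n, 1)`. -/
noncomputable def criticalValue (n : ℕ) : ℝ :=
  sSup {x : ℝ | ∃ p : I, (p : ℝ) = x ∧ 0 < x ∧ x < 1 ∧ OptimalToStop p n 1}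

end BernoulliWalk

/-! Conditioning on the first toss gives the Bellman recursion `val` in the states (n, j). Two or
more units below the maximum, stopping loses for sure; at the maximum, waiting costs nothing. So the
only real decision is in the states (n, 1). A continuation from (n, 1) is split at its next visit to
a state (m, 1). Either the walk goes up, runs along its maximum and then steps down (`runSum`), or
it makes an excursion below, weighted by a Catalan number (`returnSum`). Without such a visit it
either rises to the end and wins, with probability p^n, or stays low and loses. Hence `advantage` is
`stopGain` minus `kernel` of `excess`, and `excess` is the positive part of minus `advantage`.

On (0, 1/2] and for n ≥ 2, `stopGain` strictly decreases in p (`stopGain_lt`), so by induction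
`excess` increases and `advantage` strictly decreases; above 1/2 the advantage is negative. Thus
stopping in (n, 1) is optimal exactly up to p_n (`criticalValue_spec`).

For (a): at p = 0.46899, just above p_4, every `stopGain` except the one with n = 4 is nonnegative.
So for p ≤ p_4 all are nonnegative, all excesses vanish, and stopping is optimal in every (n, 1).
The value p_4 is the root of 1 - 2p = (p(1-p))^2.

For (b) and (c): the rule that continues until three steps remain has an explicit gain in partial
Catalan sums (`evenGain`, `oddGain`). It bounds `excess` from below, with equality while the earlier
gains are nonnegative (`gain_le_excess`, `excess_eq_gain`). In n the odd gains are unimodal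
(`oddStep_decreasing`), and a nonnegative gain in (2n+3, 1) makes all earlier gains nonnegative when
n ≥ 3 (`gain_nonneg_of_oddGain_nonneg`). At a zero of that gain, `advantage` therefore vanishes too.
Hence p_k ≤ p_{2n+3} as soon as a nonnegative gain in (2n+3, 1) forces one in (k, 1)
(`criticalValue_le_of_oddGain`), which is a polynomial inequality for k = 2n+6 and k = 2n+8. The few
small states are separated by p = 1/2 and p = 0.482. -/

namespace BernoulliWalk

/-! ### Conditioning on the first toss -/

/-- The path that begins with the toss `b` and continues with `ω`. -/
def cons (b : Bool) (ω : Path) : Path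
  | 0 => b
  | n + 1 => ω n

@[simp] theorem cons_zero (b : Bool) (ω : Path) : cons b ω 0 = b := rfl

theorem measurable_cons (b : Bool) : Measurable (cons b) := by
  refine measurable_pi_lambda _ fun n => ?_
  cases n with
  | zero => exact measurable_const
  | succ n => exact measurable_pi_apply n

instance (p : I) : IsProbabilityMeasure (law p) := by unfold law; infer_instance

/-- On a cylinder, the constraint on coordinate 0 becomes a condition on `b` and the others shift by
one. Cylinders suffice to identify a product measure. -/
theorem law_cons_preimage_pi (p : I) (b : Bool) (s : Finset ℕ) (t : ℕ → Set Bool) :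
    law p (cons b ⁻¹' Set.pi s t) =
      (if 0 ∈ s then (t 0).indicator 1 b else 1) *
        ∏ i ∈ s.erase 0, bernoulliMeasure true false p (t i) := by
  classical
  set s' : Finset ℕ := s.preimage Nat.succ Nat.succ_injective.injOn with hs'
  have hprod : ∏ i ∈ s.erase 0, bernoulliMeasure true false p (t i) =
      ∏ i ∈ s', bernoulliMeasure true false p (t (i + 1)) := by
    have : s.erase 0 = s'.map ⟨Nat.succ, Nat.succ_injective⟩ := by
      ext i
      cases i <;> simp [hs']
    rw [this, Finset.prod_map]
    rfl
  have hpi : law p (Set.pi s' fun i => t (i + 1)) =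
      ∏ i ∈ s', bernoulliMeasure true false p (t (i + 1)) :=
    Measure.infinitePi_pi _ fun _ _ => MeasurableSet.of_discrete
  by_cases h : 0 ∈ s ∧ b ∉ t 0
  · have : cons b ⁻¹' Set.pi s t = ∅ := by
      ext ω
      simp only [Set.mem_preimage, Set.mem_pi, Set.mem_empty_iff_false, iff_false]
      exact fun hω => h.2 (hω 0 h.1)
    rw [this, measure_empty, if_pos h.1, Set.indicator_of_notMem h.2, zero_mul]
  · have h1 : (if 0 ∈ s then (t 0).indicator (1 : Bool → ENNReal) b else 1) = 1 := by
      split_ifs with h0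
      · have : b ∈ t 0 := by tauto
        simp [this]
      · rfl
    have : cons b ⁻¹' Set.pi s t = Set.pi s' fun i => t (i + 1) := by
      ext ω
      simp only [Set.mem_preimage, Set.mem_pi, hs', Finset.coe_preimage]
      refine ⟨fun hω i hi => hω (i + 1) hi, fun hω i hi => ?_⟩
      cases i with
      | zero => simp only [cons_zero]; by_contra hb; exact h ⟨hi, hb⟩
      | succ i => exact hω i hi
    rw [this, h1, one_mul, hpi, hprod]

/-- Conditioning on the first toss. -/
theorem law_eq_cons (p : I) :
    law p = toNNReal p • (law p).map (cons true) + toNNReal (σ p) • (law p).map (cons false) := by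
  refine (Measure.eq_infinitePi _ fun s t _ => ?_).symm
  have hm : MeasurableSet (Set.pi (s : Set ℕ) t) :=
    MeasurableSet.pi s.countable_toSet fun _ _ => MeasurableSet.of_discrete
  rw [Measure.add_apply, Measure.smul_apply, Measure.smul_apply,
    Measure.map_apply (measurable_cons _) hm, Measure.map_apply (measurable_cons _) hm,
    law_cons_preimage_pi, law_cons_preimage_pi]
  by_cases h0 : 0 ∈ s
  · rw [if_pos h0, if_pos h0, ← Finset.mul_prod_erase s _ h0]
    have : bernoulliMeasure true false p (t 0) =
        toNNReal p • (t 0).indicator 1 true + toNNReal (σ p) • (t 0).indicator 1 false := by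
      rw [bernoulliMeasure_def, Measure.add_apply, Measure.smul_apply, Measure.smul_apply,
        Measure.dirac_apply' _ MeasurableSet.of_discrete,
        Measure.dirac_apply' _ MeasurableSet.of_discrete]
    rw [this, add_mul, smul_mul_assoc, smul_mul_assoc]
  · rw [if_neg h0, if_neg h0, Finset.erase_eq_of_notMem h0, one_mul, ← add_smul]
    have : toNNReal p + toNNReal (σ p) = 1 := by
      ext
      simp
    rw [this, one_smul]

theorem law_real_cons (p : I) {A : Set Path} (hA : MeasurableSet A) :
    (law p).real A =
      p * (law p).real (cons true ⁻¹' A) + (1 - p) * (law p).real (cons false ⁻¹' A) := by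
  conv_lhs => rw [law_eq_cons]
  rw [measureReal_add_apply, measureReal_nnreal_smul_apply, measureReal_nnreal_smul_apply,
    map_measureReal_apply (measurable_cons _) hA, map_measureReal_apply (measurable_cons _) hA]
  rfl

/-! ### Events determined by finitely many tosses -/

/-- The event `A` is determined by the first `n` tosses. -/
def DeterminedBy (n : ℕ) (A : Set Path) : Prop :=
  ∀ ω ω' : Path, (∀ i < n, ω i = ω' i) → ω ∈ A → ω' ∈ A

theorem DeterminedBy.eq_preimage {n : ℕ} {A : Set Path} (h : DeterminedBy n A) :
    ∃ B : Set (Fin n → Bool), A = (fun (ω : Path) (i : Fin n) => ω i) ⁻¹' B := by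
  refine ⟨(fun (ω : Path) (i : Fin n) => ω i) '' A, ?_⟩
  ext ω
  simp only [Set.mem_preimage, Set.mem_image]
  refine ⟨fun hω => ⟨ω, hω, rfl⟩, ?_⟩
  rintro ⟨ω', hω', he⟩
  exact h ω' ω (fun i hi => congrFun he ⟨i, hi⟩) hω'

theorem DeterminedBy.measurableSet {n : ℕ} {A : Set Path} (h : DeterminedBy n A) :
    MeasurableSet A := by
  obtain ⟨B, rfl⟩ := h.eq_preimage
  exact (measurable_pi_lambda _ fun i => measurable_pi_apply _) MeasurableSet.of_discrete

theorem S_congr {n : ℕ} {ω ω' : Path} (h : ∀ i < n, ω i = ω' i) : S n ω = S n ω' :=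
  Finset.sum_congr rfl fun i hi => by rw [h i (Finset.mem_range.1 hi)]

theorem M_congr {n : ℕ} {ω ω' : Path} (h : ∀ i < n, ω i = ω' i) : M n ω = M n ω' :=
  Finset.sup'_congr _ rfl fun k hk =>
    S_congr fun i hi => h i (by have := Finset.mem_range.1 hk; omega)

@[simp] theorem S_zero (ω : Path) : S 0 ω = 0 := rfl

theorem S_cons (b : Bool) (n : ℕ) (ω : Path) : S (n + 1) (cons b ω) = step b + S n ω := by
  rw [S, Finset.sum_range_succ', add_comm]
  rfl

theorem M_zero (ω : Path) : M 0 ω = 0 := by simp [M]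

theorem M_le_iff (n : ℕ) (ω : Path) (c : ℤ) : M n ω ≤ c ↔ ∀ k ≤ n, S k ω ≤ c := by
  simp [M, Finset.sup'_le_iff]

theorem M_nonneg (n : ℕ) (ω : Path) : 0 ≤ M n ω := (M_le_iff n ω _).1 le_rfl 0 (Nat.zero_le n)

theorem M_cons (b : Bool) (n : ℕ) (ω : Path) :
    M (n + 1) (cons b ω) = max 0 (step b + M n ω) := by
  refine eq_of_forall_ge_iff fun c => ?_
  rw [max_le_iff, M_le_iff, ← le_sub_iff_add_le', M_le_iff]
  constructor
  · refine fun h => ⟨h 0 (Nat.zero_le _), fun k hk => ?_⟩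
    have := h (k + 1) (Nat.succ_le_succ hk)
    rw [S_cons] at this
    omega
  · rintro ⟨h0, h⟩ k hk
    cases k with
    | zero => exact h0
    | succ k =>
      have := h k (Nat.succ_le_succ_iff.1 hk)
      rw [S_cons]
      omega

theorem step_injective : Function.Injective step := by
  intro a b h
  cases a <;> cases b <;> simp_all [step]

theorem step_eq_sub (n : ℕ) (ω : Path) : step (ω n) = S (n + 1) ω - S n ω := by
  simp [S, Finset.sum_range_succ]

/-! ### Stopping rules -/

theorem determinedBy_of_measurableSet {n : ℕ} {A : Set Path}
    (h : MeasurableSet[walkFiltration n] A) : DeterminedBy n A := by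
  rw [walkFiltration, Filtration.natural_eq_comap] at h
  obtain ⟨B, -, rfl⟩ := h
  intro ω ω' he hω
  have : (fun j : Set.Iic n => S j ω) = fun j : Set.Iic n => S j ω' :=
    funext fun j => S_congr fun i hi => he i (hi.trans_le j.2)
  simpa only [Set.mem_preimage, this] using hω

/-- The tosses are recovered as increments of the walk, so the walk and the tosses carry the same
information. -/
theorem DeterminedBy.measurableSet_walkFiltration {n : ℕ} {A : Set Path} (h : DeterminedBy n A) :
    MeasurableSet[walkFiltration n] A := by
  rw [walkFiltration, Filtration.natural_eq_comap]
  refine ⟨(fun (ω : Path) (j : Set.Iic n) => S j ω) '' A, MeasurableSet.of_discrete, ?_⟩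
  ext ω
  simp only [Set.mem_preimage, Set.mem_image]
  refine ⟨?_, fun hω => ⟨ω, hω, rfl⟩⟩
  rintro ⟨ω', hω', he⟩
  refine h ω' ω (fun i hi => step_injective ?_) hω'
  have h1 : S (i + 1) ω' = S (i + 1) ω := congrFun he ⟨i + 1, hi⟩
  have h2 : S i ω' = S i ω := congrFun he ⟨i, hi.le⟩
  rw [step_eq_sub, step_eq_sub, h1, h2]

theorem isStoppingRule_iff (n : ℕ) (τ : Path → ℕ) :
    IsStoppingRule n τ ↔ (∀ k, DeterminedBy k {ω | τ ω ≤ k}) ∧ ∀ ω, τ ω ≤ n := by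
  refine and_congr_left fun _ => forall_congr' fun k => ?_
  change MeasurableSet[walkFiltration k] {ω | WithTop.some (τ ω) ≤ WithTop.some k} ↔ _
  simp only [WithTop.coe_le_coe]
  exact ⟨determinedBy_of_measurableSet, DeterminedBy.measurableSet_walkFiltration⟩

theorem IsStoppingRule.congr {n : ℕ} {τ : Path → ℕ} (h : IsStoppingRule n τ) {ω ω' : Path}
    (he : ∀ i < τ ω, ω i = ω' i) : τ ω' = τ ω := by
  rw [isStoppingRule_iff] at h
  have h1 : τ ω' ≤ τ ω := h.1 (τ ω) ω ω' he (le_refl (τ ω))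
  exact le_antisymm h1 (h.1 (τ ω') ω' ω (fun i hi => (he i (hi.trans_le h1)).symm) (le_refl (τ ω')))

theorem isStoppingRule_zero (n : ℕ) : IsStoppingRule n fun _ => 0 :=
  (isStoppingRule_iff _ _).2 ⟨fun _ _ _ _ _ => Nat.zero_le _, fun _ => Nat.zero_le _⟩

/-- The winning event of the rule `τ` in the state `(n, j)`. -/
def winEvent (n j : ℕ) (τ : Path → ℕ) : Set Path :=
  {ω | max (j : ℤ) (M n ω) - S (τ ω) ω ≤ 1}

theorem IsStoppingRule.measurableSet_winEvent {n : ℕ} {τ : Path → ℕ} (h : IsStoppingRule n τ)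
    (j : ℕ) : MeasurableSet (winEvent n j τ) := by
  refine DeterminedBy.measurableSet (n := n) fun ω ω' he hω => ?_
  have hτ : τ ω' = τ ω := h.congr fun i hi => he i (hi.trans_le (h.2 ω))
  have hS : S (τ ω) ω = S (τ ω) ω' := S_congr fun i hi => he i (hi.trans_le (h.2 ω))
  simpa only [winEvent, Set.mem_ofPred_eq, hτ, M_congr he, hS] using hω

/-- The event of stopping at time 0 depends on no toss, so it is empty or everything. -/
theorem IsStoppingRule.eq_zero_or_pos {n : ℕ} {τ : Path → ℕ} (h : IsStoppingRule n τ) :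
    τ = (fun _ => 0) ∨ ∀ ω, 1 ≤ τ ω := by
  by_cases h0 : ∃ ω, τ ω = 0
  · obtain ⟨ω, hω⟩ := h0
    refine Or.inl (funext fun ω' => ?_)
    rw [h.congr (ω := ω) (ω' := ω') (by simp [hω]), hω]
  · push Not at h0
    exact Or.inr fun ω => Nat.one_le_iff_ne_zero.2 (h0 ω)

theorem IsStoppingRule.tail {n : ℕ} {τ : Path → ℕ} (h : IsStoppingRule (n + 1) τ)
    (b : Bool) : IsStoppingRule n fun ω => τ (cons b ω) - 1 := by
  have h' := (isStoppingRule_iff _ _).1 h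
  refine (isStoppingRule_iff _ _).2 ⟨fun k ω ω' he hω => ?_, fun ω => ?_⟩
  · have : τ (cons b ω') ≤ k + 1 := by
      refine h'.1 (k + 1) (cons b ω) (cons b ω') (fun i hi => ?_) ?_
      · cases i with
        | zero => rfl
        | succ i => exact he i (by omega)
      · simp only [Set.mem_ofPred_eq] at hω ⊢
        omega
    simp only [Set.mem_ofPred_eq]
    omega
  · have := h.2 (cons b ω)
    omega

/-- The rule that tosses once and then follows `τ b`, where `b` is the outcome. -/
def afterToss (τ : Bool → Path → ℕ) (ω : Path) : ℕ := τ (ω 0) (fun n => ω (n + 1)) + 1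

theorem isStoppingRule_afterToss {n : ℕ} {τ : Bool → Path → ℕ} (h : ∀ b, IsStoppingRule n (τ b)) :
    IsStoppingRule (n + 1) (afterToss τ) := by
  refine (isStoppingRule_iff _ _).2 ⟨fun k ω ω' he hω => ?_, fun ω => ?_⟩
  · simp only [Set.mem_ofPred_eq, afterToss] at hω ⊢
    rw [← he 0 (by omega)]
    cases k with
    | zero => omega
    | succ k =>
      refine Nat.succ_le_succ (((isStoppingRule_iff _ _).1 (h (ω 0))).1 k (fun n => ω (n + 1)) _
        (fun i hi => he (i + 1) (by omega)) ?_)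
      simp only [Set.mem_ofPred_eq]
      omega
  · exact Nat.succ_le_succ ((h (ω 0)).2 _)

@[simp] theorem afterToss_cons (τ : Bool → Path → ℕ) (b : Bool) (ω : Path) :
    afterToss τ (cons b ω) = τ b ω + 1 := rfl

/-- The truncated subtraction `j - 1` is the right dynamics at `j = 0`: an up-step at the maximum
creates a new maximum and leaves the distance 0. -/
theorem cons_preimage_winEvent (n j : ℕ) (b : Bool) {τ τ' : Path → ℕ}
    (hτ : ∀ ω, τ (cons b ω) = τ' ω + 1) :
    cons b ⁻¹' winEvent (n + 1) j τ = winEvent n (if b then j - 1 else j + 1) τ' := by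
  ext ω
  have hM := M_nonneg n ω
  simp only [winEvent, Set.mem_preimage, Set.mem_ofPred_eq, hτ, M_cons, S_cons]
  cases b <;> simp only [step, if_true, Bool.false_eq_true, if_false] <;> push_cast <;> omega

theorem winProb_succ (p : I) (n j : ℕ) {τ : Path → ℕ} (h : IsStoppingRule (n + 1) τ)
    {τ' : Bool → Path → ℕ} (hτ : ∀ b ω, τ (cons b ω) = τ' b ω + 1) :
    winProb p (n + 1) j τ =
      p * winProb p n (j - 1) (τ' true) + (1 - p) * winProb p n (j + 1) (τ' false) := by
  rw [winProb, ← winEvent, law_real_cons p (h.measurableSet_winEvent j),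
    cons_preimage_winEvent n j true (hτ true), cons_preimage_winEvent n j false (hτ false)]
  rfl

/-! ### Dynamic programming -/

/-- `surv p n k` is the probability that the running maximum after `n` steps is less than `k`. -/
noncomputable def surv (p : ℝ) : ℕ → ℕ → ℝ
  | 0, k => if k = 0 then 0 else 1
  | _ + 1, 0 => 0
  | n + 1, k + 1 => p * surv p n k + (1 - p) * surv p n (k + 2)

theorem law_real_M_lt (p : I) (n k : ℕ) : (law p).real {ω | M n ω < k} = surv p n k := by
  induction n generalizing k with
  | zero =>
    cases k with
    | zero => simp [surv, M_zero]
    | succ k =>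
      have : {ω | M 0 ω < ((k + 1 : ℕ) : ℤ)} = Set.univ := by
        ext ω
        simp [M_zero]
      rw [this]
      simp [surv]
  | succ n ih =>
    cases k with
    | zero =>
      have : {ω | M (n + 1) ω < ((0 : ℕ) : ℤ)} = ∅ := by
        ext ω
        have := M_nonneg (n + 1) ω
        simp only [Set.mem_ofPred_eq, Set.mem_empty_iff_false, iff_false]
        omega
      rw [this]
      simp [surv]
    | succ k =>
      have hm : MeasurableSet {ω | M (n + 1) ω < ((k + 1 : ℕ) : ℤ)} :=
        DeterminedBy.measurableSet (n := n + 1) fun ω ω' he hω => by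
          simpa only [Set.mem_ofPred_eq, M_congr he] using hω
      rw [law_real_cons p hm, surv, ← ih, ← ih]
      congr 3 <;>
      · ext ω
        simp only [Set.mem_preimage, Set.mem_ofPred_eq, M_cons, step, if_true,
          Bool.false_eq_true, if_false]
        push_cast
        omega

/-- The probability to win by stopping at once in the state `(n, j)`. -/
noncomputable def stopVal (p : ℝ) (n j : ℕ) : ℝ := if j ≤ 1 then surv p n 2 else 0

theorem winProb_zero (p : I) (n j : ℕ) : winProb p n j (fun _ => 0) = stopVal p n j := by
  rw [winProb, stopVal]
  split_ifs with h
  · rw [← law_real_M_lt]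
    congr 1
    ext ω
    simp only [Set.mem_ofPred_eq, S_zero]
    push_cast
    omega
  · have : {ω | max (j : ℤ) (M n ω) - S 0 ω ≤ 1} = ∅ := by
      ext ω
      simp only [Set.mem_ofPred_eq, S_zero, Set.mem_empty_iff_false, iff_false]
      omega
    rw [this]
    simp

/-- The maximal probability to win from the state `(n, j)`. -/
noncomputable def val (p : ℝ) : ℕ → ℕ → ℝ
  | 0, j => stopVal p 0 j
  | n + 1, j => max (stopVal p (n + 1) j) (p * val p n (j - 1) + (1 - p) * val p n (j + 1))

theorem winProb_le_val (p : I) (n j : ℕ) {τ : Path → ℕ} (h : IsStoppingRule n τ) :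
    winProb p n j τ ≤ val p n j := by
  induction n generalizing j τ with
  | zero =>
    have : τ = fun _ => 0 := funext fun ω => Nat.le_zero.1 (h.2 ω)
    rw [this, winProb_zero, val]
  | succ n ih =>
    rcases h.eq_zero_or_pos with rfl | hpos
    · rw [winProb_zero, val]
      exact le_max_left _ _
    · rw [winProb_succ p n j h (τ' := fun b ω => τ (cons b ω) - 1)
        fun b ω => (Nat.sub_add_cancel (hpos _)).symm, val]
      refine le_max_of_le_right (add_le_add ?_ ?_)
      · exact mul_le_mul_of_nonneg_left (ih _ (h.tail true)) p.2.1
      · exact mul_le_mul_of_nonneg_left (ih _ (h.tail false)) (sub_nonneg.2 p.2.2)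

theorem exists_winProb_eq_val (p : I) (n j : ℕ) :
    ∃ τ, IsStoppingRule n τ ∧ winProb p n j τ = val p n j := by
  induction n generalizing j with
  | zero => exact ⟨_, isStoppingRule_zero 0, winProb_zero p 0 j⟩
  | succ n ih =>
    rw [val]
    rcases le_total (p * val p n (j - 1) + (1 - p) * val p n (j + 1))
      (stopVal p (n + 1) j) with hle | hle
    · rw [max_eq_left hle]
      exact ⟨_, isStoppingRule_zero _, winProb_zero p _ j⟩
    · rw [max_eq_right hle]
      obtain ⟨τ₁, h₁, e₁⟩ := ih (j - 1)
      obtain ⟨τ₂, h₂, e₂⟩ := ih (j + 1)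
      have h : IsStoppingRule (n + 1) (afterToss fun b => if b then τ₁ else τ₂) :=
        isStoppingRule_afterToss fun b => by cases b <;> simpa
      refine ⟨_, h, ?_⟩
      rw [winProb_succ p n j h fun b ω => afterToss_cons _ b ω]
      simp [e₁, e₂]

theorem optimalToStop_iff (p : I) (n j : ℕ) : OptimalToStop p n j ↔ val p n j ≤ stopVal p n j := by
  rw [OptimalToStop, winProb_zero]
  constructor
  · intro h
    obtain ⟨τ, hτ, he⟩ := exists_winProb_eq_val p n j
    exact he ▸ h τ hτ
  · exact fun h τ hτ => (winProb_le_val p n j hτ).trans h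

/-! ### Catalan weights -/

/-- The weight `C_n (p (1 - p))^n` of the excursions of length `2 n`. -/
noncomputable def cat (p : ℝ) (n : ℕ) : ℝ := catalan n * (p * (1 - p)) ^ n

/-- Partial sums of the Catalan weights. -/
noncomputable def catSum (p : ℝ) (m : ℕ) : ℝ := ∑ i ∈ Finset.range m, cat p i

@[simp] theorem cat_zero (p : ℝ) : cat p 0 = 1 := by simp [cat]

@[simp] theorem catSum_zero (p : ℝ) : catSum p 0 = 0 := by simp [catSum]

@[simp] theorem catSum_one (p : ℝ) : catSum p 1 = 1 := by simp [catSum]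

theorem catSum_succ (p : ℝ) (m : ℕ) : catSum p (m + 1) = catSum p m + cat p m :=
  Finset.sum_range_succ _ _

theorem cat_conv (p : ℝ) (m : ℕ) :
    ∑ i ∈ Finset.range (m + 1), p * (1 - p) * cat p i * cat p (m - i) = cat p (m + 1) := by
  rw [cat, catalan_succ, Nat.cast_sum, Finset.sum_mul, Finset.sum_range]
  refine Finset.sum_congr rfl fun i _ => ?_
  rw [cat, cat, pow_succ, Nat.cast_mul]
  have : (p * (1 - p)) ^ m = (p * (1 - p)) ^ (i : ℕ) * (p * (1 - p)) ^ (m - i : ℕ) := by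
    rw [← pow_add, Nat.add_sub_cancel' (Nat.lt_succ_iff.1 i.2)]
  rw [this]
  ring

/-- Groups pairs of successive excursions by total length; this is the Catalan recursion tested
against `f`. -/
theorem sum_cat_mul_eq (p : ℝ) (f : ℕ → ℝ) (N : ℕ) :
    ∑ i ∈ Finset.range N, p * (1 - p) * cat p i * ∑ k ∈ Finset.range (N - i), cat p k * f (i + k) =
      ∑ m ∈ Finset.range N, cat p (m + 1) * f m := by
  simp_rw [← cat_conv, Finset.sum_mul, Finset.mul_sum]
  rw [← Finset.sum_range_diag_flip N fun i k => p * (1 - p) * cat p i * (cat p k * f (i + k))]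
  refine Finset.sum_congr rfl fun m _ => Finset.sum_congr rfl fun i hi => ?_
  rw [Nat.add_sub_cancel' (Nat.lt_succ_iff.1 (Finset.mem_range.1 hi))]
  ring

theorem catSum_conv (p : ℝ) (N : ℕ) :
    ∑ i ∈ Finset.range N, p * (1 - p) * cat p i * catSum p (N - i) = catSum p (N + 1) - 1 := by
  have := sum_cat_mul_eq p (fun _ => 1) N
  simp only [mul_one] at this
  rw [catSum, Finset.sum_range_succ', cat_zero, add_sub_cancel_right, ← this]
  rfl

theorem cat_succ (p : ℝ) (n : ℕ) :
    (n + 2) * cat p (n + 1) = 2 * (p * (1 - p)) * (2 * n + 1) * cat p n := by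
  have h1 := succ_mul_catalan_eq_centralBinom n
  have h2 := succ_mul_catalan_eq_centralBinom (n + 1)
  have h3 := Nat.succ_mul_centralBinom_succ n
  rw [← h1, ← h2] at h3
  have h4 : ((n : ℝ) + 2) * catalan (n + 1) = 2 * (2 * n + 1) * catalan n := by
    have h5 : (n + 1) * ((n + 2) * catalan (n + 1)) = (n + 1) * (2 * (2 * n + 1) * catalan n) := by
      linarith
    exact_mod_cast Nat.eq_of_mul_eq_mul_left n.succ_pos h5
  rw [cat, cat, pow_succ]
  linear_combination (p * (1 - p)) ^ n * (p * (1 - p)) * h4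

theorem cat_one (p : ℝ) : cat p 1 = p * (1 - p) := by simp [cat]

theorem cat_pos {p : ℝ} (h0 : 0 < p) (h1 : p < 1) (n : ℕ) : 0 < cat p n := by
  induction n with
  | zero => simp
  | succ n ih =>
    have h := cat_succ p n
    have hr : 0 < p * (1 - p) := mul_pos h0 (sub_pos.2 h1)
    have : 0 < ((n : ℝ) + 2) * cat p (n + 1) := by rw [h]; positivity
    exact pos_of_mul_pos_right this (by positivity)

/-! ### The first passage decomposition -/

/-- The contribution of the returns from below. -/
noncomputable def returnSum (p : ℝ) (x : ℕ → ℝ) (n : ℕ) : ℝ :=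
  ∑ i ∈ Finset.range (n / 2), p * (1 - p) * cat p i * x (n - 2 - 2 * i)

/-- The contribution of the returns from above, when the walk has run up to a new maximum. -/
noncomputable def runSum (p : ℝ) (x : ℕ → ℝ) : ℕ → ℝ
  | 0 => 0
  | m + 1 => p * runSum p x m + p * (1 - p) * x m

/-- The expected value of `x` at the first return to the set of states one unit below the maximum. -/
noncomputable def kernel (p : ℝ) (x : ℕ → ℝ) (n : ℕ) : ℝ := runSum p x (n - 1) + returnSum p x n

/-- First passage: to leave level `j + 1` upwards, the walk completes an excursion of length `2 i`
below and then steps to `j`. The prefactor `1 - p` is the down-step that precedes. It serves for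
hitting probabilities as well as for `val`. -/
theorem returnSum_eq (p : ℝ) {y : ℕ → ℕ → ℝ} (h0 : ∀ j, y 0 (j + 1) = 0)
    (hs : ∀ n j, y (n + 1) (j + 1) = p * y n j + (1 - p) * y n (j + 2)) (n j : ℕ) :
    (1 - p) * y n (j + 1) = returnSum p (fun m => y m j) (n + 1) := by
  induction n using Nat.strong_induction_on generalizing j with
  | _ n ih =>
    cases n with
    | zero => simp [h0, returnSum]
    | succ n =>
      have h1 : (1 - p) * y n (j + 2) =
          ∑ i ∈ Finset.range (n / 2), p * (1 - p) * cat p i * y (n - 1 - 2 * i) (j + 1) := by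
        rw [ih n n.lt_succ_self (j + 1), returnSum]
        rcases Nat.even_or_odd' n with ⟨k, rfl | rfl⟩
        · rw [show (2 * k + 1) / 2 = 2 * k / 2 by omega]
          exact Finset.sum_congr rfl fun i _ => by congr 2
        -- The additional term has no time left and vanishes by `h0`.
        · rw [show (2 * k + 1 + 1) / 2 = k + 1 by omega, show (2 * k + 1) / 2 = k by omega,
            Finset.sum_range_succ, show 2 * k + 1 + 1 - 2 - 2 * k = 0 by omega, h0, mul_zero,
            add_zero]
          exact Finset.sum_congr rfl fun i _ => by congr 2
      -- The passage from `j + 2` to `j` goes through `j + 1`; two first passages are merged by the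
      -- Catalan convolution.
      have h2 : (1 - p) * ((1 - p) * y n (j + 2)) =
          ∑ m ∈ Finset.range (n / 2), p * (1 - p) * cat p (m + 1) * y (n - 2 - 2 * m) j := by
        rw [h1, Finset.mul_sum]
        have h3 := sum_cat_mul_eq p (fun m => p * (1 - p) * y (n - 2 - 2 * m) j) (n / 2)
        calc _ = ∑ i ∈ Finset.range (n / 2), p * (1 - p) * cat p i *
              ∑ k ∈ Finset.range (n / 2 - i), cat p k *
                (p * (1 - p) * y (n - 2 - 2 * (i + k)) j) := by
              refine Finset.sum_congr rfl fun i hi => ?_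
              have hi' := Finset.mem_range.1 hi
              rw [mul_left_comm, ih (n - 1 - 2 * i) (by omega) j, returnSum,
                show (n - 1 - 2 * i + 1) / 2 = n / 2 - i by omega]
              congr 1
              refine Finset.sum_congr rfl fun k hk => ?_
              rw [show n - 1 - 2 * i + 1 - 2 - 2 * k = n - 2 - 2 * (i + k) by
                have := Finset.mem_range.1 hk; omega]
              ring
          _ = _ := by
              rw [h3]
              exact Finset.sum_congr rfl fun m _ => by ring
      rw [hs, mul_add, h2, returnSum, show (n + 1 + 1) / 2 = n / 2 + 1 by omega,
        Finset.sum_range_succ', cat_zero, add_comm]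
      congr 1
      · refine Finset.sum_congr rfl fun m _ => ?_
        rw [show n + 1 + 1 - 2 - 2 * (m + 1) = n - 2 - 2 * m by omega]
      · rw [show n + 1 + 1 - 2 - 2 * 0 = n by omega]
        ring

theorem returnSum_add (p : ℝ) (x y : ℕ → ℝ) (n : ℕ) :
    returnSum p (fun m => x m + y m) n = returnSum p x n + returnSum p y n := by
  simp only [returnSum, mul_add, Finset.sum_add_distrib]

theorem runSum_add (p : ℝ) (x y : ℕ → ℝ) (n : ℕ) :
    runSum p (fun m => x m + y m) n = runSum p x n + runSum p y n := by
  induction n with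
  | zero => simp [runSum]
  | succ n ih => simp only [runSum, ih]; ring

theorem kernel_add (p : ℝ) (x y : ℕ → ℝ) (n : ℕ) :
    kernel p (fun m => x m + y m) n = kernel p x n + kernel p y n := by
  rw [kernel, kernel, kernel, runSum_add, returnSum_add]
  ring

theorem kernel_succ (p : ℝ) (x : ℕ → ℝ) (n : ℕ) :
    kernel p x (n + 2) = p * (kernel p x (n + 1) - returnSum p x (n + 1)) + p * (1 - p) * x n +
      returnSum p x (n + 2) := by
  simp only [kernel, Nat.add_sub_cancel, show n + 2 - 1 = n + 1 by omega, runSum]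
  ring

/-! ### The probability to win by stopping -/

section

variable {p : ℝ}

theorem one_sub_surv_one (p : ℝ) (n : ℕ) :
    (1 - p) * (1 - surv p n 1) = p * (1 - p) * catSum p ((n + 1) / 2) := by
  have := returnSum_eq p (y := fun n k => 1 - surv p n k) (fun j => by simp [surv])
    (fun n j => by simp only [surv]; ring) n 0
  simp only [zero_add] at this
  rw [this, returnSum, catSum, Finset.mul_sum]
  refine Finset.sum_congr rfl fun i _ => ?_
  have h0 : ∀ m, surv p m 0 = 0 := fun m => by cases m <;> simp [surv]
  rw [h0]
  ring

/-- To reach level 2 the walk must reach level 1 and then climb one level more; convolving the two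
first passage laws gives a partial Catalan sum again. -/
theorem surv_two (hp : p ≠ 1) (n : ℕ) :
    surv p n 2 = 1 - p / (1 - p) * (catSum p (n / 2 + 1) - 1) := by
  have hq : 1 - p ≠ 0 := sub_ne_zero.2 hp.symm
  have h1 := returnSum_eq p (y := fun n k => 1 - surv p n k) (fun j => by simp [surv])
    (fun n j => by simp only [surv]; ring) n 1
  have h2 : (1 - p) * returnSum p (fun m => 1 - surv p m 1) (n + 1) =
      p * (1 - p) * (catSum p (n / 2 + 1) - 1) := by
    have h3 : (1 - p) * returnSum p (fun m => 1 - surv p m 1) (n + 1) =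
        p * (1 - p) * ∑ i ∈ Finset.range ((n + 1) / 2),
          p * (1 - p) * cat p i * catSum p (n / 2 - i) := by
      rw [returnSum, Finset.mul_sum, Finset.mul_sum]
      refine Finset.sum_congr rfl fun i hi => ?_
      have hi' := Finset.mem_range.1 hi
      rw [mul_left_comm, one_sub_surv_one,
        show (n + 1 - 2 - 2 * i + 1) / 2 = n / 2 - i by omega]
      ring
    rw [h3, ← catSum_conv]
    congr 1
    rcases Nat.even_or_odd' n with ⟨k, rfl | rfl⟩
    · rw [show (2 * k + 1) / 2 = 2 * k / 2 by omega]
    · rw [show (2 * k + 1 + 1) / 2 = k + 1 by omega, show (2 * k + 1) / 2 = k by omega,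
        Finset.sum_range_succ, Nat.sub_self, catSum_zero, mul_zero, add_zero]
  rw [← h1] at h2
  norm_num at h2
  field_simp
  have h4 : (1 - p) * ((1 - p) * (1 - surv p n 2)) = (1 - p) * (p * (catSum p (n / 2 + 1) - 1)) := by
    rw [h2]; ring
  have := mul_left_cancel₀ hq h4
  linarith

/-- The loss from stopping at the first return instead of stopping at once. -/
noncomputable def stopGain (p : ℝ) (n : ℕ) : ℝ :=
  surv p n 2 - p ^ n - kernel p (fun m => surv p m 2) n

theorem returnSum_surv (hp : p ≠ 1) (n : ℕ) :
    returnSum p (fun m => surv p m 2) n =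
      p * catSum p (n / 2) - p / (1 - p) * (catSum p (n / 2 + 1) - 1) := by
  have hq : 1 - p ≠ 0 := sub_ne_zero.2 hp.symm
  have : ∀ i ∈ Finset.range (n / 2), p * (1 - p) * cat p i * surv p (n - 2 - 2 * i) 2 =
      p * cat p i - p / (1 - p) * (p * (1 - p) * cat p i * catSum p (n / 2 - i)) := by
    intro i hi
    have hi' := Finset.mem_range.1 hi
    rw [surv_two hp, show (n - 2 - 2 * i) / 2 + 1 = n / 2 - i by omega]
    field_simp
    ring
  rw [returnSum, Finset.sum_congr rfl this, Finset.sum_sub_distrib, ← Finset.mul_sum,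
    ← Finset.mul_sum, catSum_conv]
  rfl

theorem stopGain_eq (hp : p ≠ 1) (n : ℕ) :
    stopGain p n =
      1 - p * catSum p (n / 2) - p ^ n - runSum p (fun m => surv p m 2) (n - 1) := by
  rw [stopGain, kernel, returnSum_surv hp, surv_two hp]
  ring

theorem stopGain_one (hp : p ≠ 1) : stopGain p 1 = 1 - p := by
  rw [stopGain_eq hp]
  simp [runSum]

theorem stopGain_succ (hp : p ≠ 1) (n : ℕ) :
    stopGain p (n + 2) = p * stopGain p (n + 1) + (1 - 2 * p) -
      p * (1 - p) * catSum p (n / 2 + 1) + p ^ 2 * catSum p ((n + 1) / 2) := by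
  have hq : 1 - p ≠ 0 := sub_ne_zero.2 hp.symm
  rw [stopGain_eq hp, stopGain_eq hp, show n + 2 - 1 = n + 1 by omega, runSum,
    Nat.add_sub_cancel, surv_two hp, show (n + 2) / 2 = n / 2 + 1 by omega]
  field_simp
  ring

theorem stopGain_two (hp : p ≠ 1) : stopGain p 2 = 1 - 2 * p := by
  rw [stopGain_succ hp 0, stopGain_one hp]
  norm_num
  try ring

/-! ### The advantage of stopping -/

/-- The amount by which the optimal value in the state `(n, 1)` exceeds the value of stopping. -/
noncomputable def excess (p : ℝ) (n : ℕ) : ℝ := val p n 1 - surv p n 2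

/-- The advantage of stopping in the state `(n, 1)` over tossing once more and then continuing
optimally. -/
noncomputable def advantage (p : ℝ) (n : ℕ) : ℝ := stopGain p n - kernel p (excess p) n

theorem stopVal_one (p : ℝ) (n : ℕ) : stopVal p n 1 = surv p n 2 := by simp [stopVal]

theorem stopVal_zero (p : ℝ) (n : ℕ) : stopVal p n 0 = surv p n 2 := by simp [stopVal]

theorem stopVal_add_two (p : ℝ) (n j : ℕ) : stopVal p n (j + 2) = 0 := by simp [stopVal]

theorem surv_nonneg (h0 : 0 ≤ p) (h1 : p ≤ 1) (n k : ℕ) : 0 ≤ surv p n k := by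
  induction n generalizing k with
  | zero => rw [surv]; split_ifs <;> norm_num
  | succ n ih =>
    cases k with
    | zero => simp [surv]
    | succ k => exact add_nonneg (mul_nonneg h0 (ih _)) (mul_nonneg (sub_nonneg.2 h1) (ih _))

theorem surv_le_one (h0 : 0 ≤ p) (h1 : p ≤ 1) (n k : ℕ) : surv p n k ≤ 1 := by
  induction n generalizing k with
  | zero => rw [surv]; split_ifs <;> norm_num
  | succ n ih =>
    cases k with
    | zero => simp [surv]
    | succ k =>
      have h2 := mul_le_mul_of_nonneg_left (ih k) h0
      have h3 := mul_le_mul_of_nonneg_left (ih (k + 2)) (sub_nonneg.2 h1)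
      rw [surv]
      linarith

theorem surv_succ_le (h0 : 0 ≤ p) (h1 : p ≤ 1) (n k : ℕ) : surv p (n + 1) k ≤ surv p n k := by
  induction n generalizing k with
  | zero =>
    cases k with
    | zero => simp [surv]
    | succ k => simpa [surv] using surv_le_one h0 h1 1 (k + 1)
  | succ n ih =>
    cases k with
    | zero => simp [surv]
    | succ k =>
      change p * surv p (n + 1) k + (1 - p) * surv p (n + 1) (k + 2) ≤
        p * surv p n k + (1 - p) * surv p n (k + 2)
      exact add_le_add (mul_le_mul_of_nonneg_left (ih _) h0)
        (mul_le_mul_of_nonneg_left (ih _) (sub_nonneg.2 h1))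

theorem stopVal_le_val (p : ℝ) (n j : ℕ) : stopVal p n j ≤ val p n j := by
  cases n with
  | zero => exact le_rfl
  | succ n => exact le_max_left _ _

theorem val_nonneg (h0 : 0 ≤ p) (h1 : p ≤ 1) (n j : ℕ) : 0 ≤ val p n j := by
  refine le_trans ?_ (stopVal_le_val p n j)
  rw [stopVal]
  split_ifs
  exacts [surv_nonneg h0 h1 _ _, le_rfl]

theorem val_succ_add_two (h0 : 0 ≤ p) (h1 : p ≤ 1) (n j : ℕ) :
    val p (n + 1) (j + 2) = p * val p n (j + 1) + (1 - p) * val p n (j + 3) := by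
  rw [val, stopVal_add_two]
  exact max_eq_right (add_nonneg (mul_nonneg h0 (val_nonneg h0 h1 _ _))
    (mul_nonneg (sub_nonneg.2 h1) (val_nonneg h0 h1 _ _)))

/-- At the maximum, tossing is free: stopping remains possible after either outcome, and with less
time left it wins at least as often. -/
theorem val_succ_zero (h0 : 0 ≤ p) (h1 : p ≤ 1) (n : ℕ) :
    val p (n + 1) 0 = p * val p n 0 + (1 - p) * val p n 1 := by
  rw [val, stopVal_zero]
  refine max_eq_right ((surv_succ_le h0 h1 n 2).trans ?_)
  have h2 := mul_le_mul_of_nonneg_left (stopVal_le_val p n 0) h0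
  have h3 := mul_le_mul_of_nonneg_left (stopVal_le_val p n 1) (sub_nonneg.2 h1)
  rw [stopVal_zero] at h2
  rw [stopVal_one] at h3
  simp only [Nat.zero_sub, zero_add]
  linarith

/-- From the maximum the walk either rises to the end, which wins, or takes a first down-step into a
state `(m, 1)`. -/
theorem mul_val_zero (h0 : 0 ≤ p) (h1 : p ≤ 1) (n : ℕ) :
    p * val p n 0 = p ^ (n + 1) + runSum p (fun m => val p m 1) n := by
  induction n with
  | zero => simp [val, stopVal, surv, runSum]
  | succ n ih =>
    rw [val_succ_zero h0 h1, mul_add, ih, runSum]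
    ring

theorem val_two (h0 : 0 ≤ p) (h1 : p ≤ 1) (n : ℕ) :
    (1 - p) * val p n 2 = returnSum p (fun m => val p m 1) (n + 1) :=
  returnSum_eq p (y := fun n j => val p n (j + 1))
    (fun j => by simp [val, stopVal_add_two]) (fun n j => val_succ_add_two h0 h1 n j) n 0

theorem excess_add_surv (p : ℝ) (n : ℕ) : excess p n + surv p n 2 = val p n 1 := by
  rw [excess]
  ring

/-- By linearity of `kernel`, the survival term inside `stopGain` and the excess add up to `val p m
1` at the return. -/
theorem advantage_succ (h0 : 0 ≤ p) (h1 : p ≤ 1) (n : ℕ) :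
    advantage p (n + 1) =
      surv p (n + 1) 2 - (p * val p n 0 + (1 - p) * val p n 2) := by
  have h := kernel_add p (excess p) (fun m => surv p m 2) (n + 1)
  simp only [excess_add_surv] at h
  rw [mul_val_zero h0 h1, val_two h0 h1, advantage, stopGain]
  rw [kernel, Nat.add_sub_cancel] at h
  linarith

theorem excess_zero (p : ℝ) : excess p 0 = 0 := by simp [excess, val, stopVal]

theorem excess_succ (h0 : 0 ≤ p) (h1 : p ≤ 1) (n : ℕ) :
    excess p (n + 1) = max 0 (-advantage p (n + 1)) := by
  rw [advantage_succ h0 h1, excess, val, stopVal_one, Nat.sub_self]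
  rw [← max_sub_sub_right]
  congr 1 <;> ring

theorem excess_nonneg (p : ℝ) (n : ℕ) : 0 ≤ excess p n := by
  rw [excess, sub_nonneg, ← stopVal_one]
  exact stopVal_le_val p n 1

theorem optimalToStop_iff_advantage {p : I} {n : ℕ} (hn : 1 ≤ n) :
    OptimalToStop p n 1 ↔ 0 ≤ advantage p n := by
  obtain ⟨n, rfl⟩ := Nat.exists_eq_add_of_le' hn
  rw [optimalToStop_iff, stopVal_one, ← sub_nonpos, ← excess, excess_succ p.2.1 p.2.2,
    max_le_iff]
  simp

theorem returnSum_nonneg (h0 : 0 < p) (h1 : p < 1) {x : ℕ → ℝ} {n : ℕ} (hx : ∀ i < n, 0 ≤ x i) :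
    0 ≤ returnSum p x n := by
  refine Finset.sum_nonneg fun i hi => ?_
  have hi' := Finset.mem_range.1 hi
  exact mul_nonneg (mul_nonneg (mul_pos h0 (sub_pos.2 h1)).le (cat_pos h0 h1 i).le)
    (hx _ (by omega))

theorem runSum_nonneg (h0 : 0 < p) (h1 : p < 1) {x : ℕ → ℝ} {n : ℕ} (hx : ∀ i < n, 0 ≤ x i) :
    0 ≤ runSum p x n := by
  induction n with
  | zero => simp [runSum]
  | succ n ih =>
    exact add_nonneg (mul_nonneg h0.le (ih fun i hi => hx i (by omega)))
      (mul_nonneg (mul_pos h0 (sub_pos.2 h1)).le (hx n n.lt_succ_self))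

theorem kernel_nonneg (h0 : 0 < p) (h1 : p < 1) {x : ℕ → ℝ} {n : ℕ} (hx : ∀ i < n, 0 ≤ x i) :
    0 ≤ kernel p x n :=
  add_nonneg (runSum_nonneg h0 h1 fun i hi => hx i (by omega)) (returnSum_nonneg h0 h1 hx)

theorem kernel_congr (p : ℝ) {x y : ℕ → ℝ} {n : ℕ} (h : ∀ i < n, x i = y i) :
    kernel p x n = kernel p y n := by
  have h1 : ∀ m ≤ n, runSum p x m = runSum p y m := by
    intro m hm
    induction m with
    | zero => rfl
    | succ m ih => rw [runSum, runSum, ih (by omega), h m hm]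
  rw [kernel, kernel, h1 _ (Nat.sub_le _ _), returnSum, returnSum]
  congr 1
  refine Finset.sum_congr rfl fun i hi => ?_
  rw [h _ (by have := Finset.mem_range.1 hi; omega)]

theorem kernel_mono (h0 : 0 < p) (h1 : p < 1) {x y : ℕ → ℝ} {n : ℕ} (h : ∀ i < n, x i ≤ y i) :
    kernel p x n ≤ kernel p y n := by
  have h2 := kernel_nonneg h0 h1 (x := fun i => y i - x i) fun i hi => sub_nonneg.2 (h i hi)
  have h3 := kernel_add p x (fun i => y i - x i) n
  simp only [add_sub_cancel] at h3
  linarith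

end

/-! ### Monotonicity in the parameter -/

section

variable {p p' : ℝ}

/-- The generating function satisfies C = 1 + p(1-p)C², of which 1/(1-p) is a fixed point; partial
sums stay below it by induction. -/
theorem catSum_le (h0 : 0 < p) (h1 : p < 1) (n : ℕ) : catSum p n ≤ 1 / (1 - p) := by
  have hq : 0 < 1 - p := sub_pos.2 h1
  induction n using Nat.strong_induction_on with
  | _ n ih =>
    cases n with
    | zero => simpa using hq.le
    | succ n =>
      have h2 : catSum p (n + 1) - 1 ≤ p * catSum p n := by
        rw [← catSum_conv, catSum, Finset.mul_sum]
        refine Finset.sum_le_sum fun i _ => ?_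
        have h3 := ih (n - i) (by omega)
        calc _ ≤ p * (1 - p) * cat p i * (1 / (1 - p)) :=
              mul_le_mul_of_nonneg_left h3
                (mul_nonneg (mul_pos h0 hq).le (cat_pos h0 h1 i).le)
          _ = _ := by field_simp
      have h4 := mul_le_mul_of_nonneg_left (ih n n.lt_succ_self) h0.le
      have h5 : 1 + p * (1 / (1 - p)) = 1 / (1 - p) := by field_simp; ring
      linarith

theorem catSum_lt (h0 : 0 < p) (h1 : p < 1) (n : ℕ) : catSum p n < 1 / (1 - p) := by
  have h2 := catSum_le h0 h1 (n + 1)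
  rw [catSum_succ] at h2
  linarith [cat_pos h0 h1 n]

theorem cat_symm (p : ℝ) (n : ℕ) : cat (1 - p) n = cat p n := by
  rw [cat, cat, sub_sub_cancel, mul_comm p]

theorem catSum_symm (p : ℝ) (n : ℕ) : catSum (1 - p) n = catSum p n := by
  simp only [catSum, cat_symm]

theorem catSum_lt' (h0 : 0 < p) (h1 : p < 1) (n : ℕ) : catSum p n < 1 / p := by
  have := catSum_lt (sub_pos.2 h1) (sub_lt_self 1 h0) n
  rwa [catSum_symm, sub_sub_cancel] at this

theorem mul_one_sub_le (hpp : p ≤ p') (h2 : p' ≤ 1 / 2) : p * (1 - p) ≤ p' * (1 - p') := by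
  nlinarith

theorem cat_le_cat (h0 : 0 < p) (hpp : p ≤ p') (h2 : p' ≤ 1 / 2) (n : ℕ) :
    cat p n ≤ cat p' n :=
  mul_le_mul_of_nonneg_left
    (pow_le_pow_left₀ (mul_nonneg h0.le (by linarith)) (mul_one_sub_le hpp h2) n) (Nat.cast_nonneg _)

/-- The difference between `p` and `p ^ 2 + ⋯ + p ^ s`. -/
noncomputable def runDeficit (p : ℝ) : ℕ → ℝ
  | 0 => 2 * p
  | s + 1 => p * runDeficit p s + p * (1 - 2 * p)

theorem one_sub_mul_runDeficit (p : ℝ) (s : ℕ) :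
    (1 - p) * runDeficit p s = p * (1 - 2 * p) + p ^ (s + 1) := by
  induction s with
  | zero => simp only [runDeficit]; ring
  | succ s ih => simp only [runDeficit]; linear_combination p * ih

theorem runDeficit_nonneg (h0 : 0 < p) (h2 : p ≤ 1 / 2) (s : ℕ) : 0 ≤ runDeficit p s := by
  induction s with
  | zero => simp only [runDeficit]; linarith
  | succ s ih => simp only [runDeficit]; exact add_nonneg (by positivity) (mul_nonneg h0.le (by linarith))

theorem runDeficit_sub_le (h0 : 0 < p) (hpp : p ≤ p') (h2 : p' ≤ 1 / 2) (s : ℕ) :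
    runDeficit p s - runDeficit p' s ≤ 2 * (p' - p) := by
  induction s with
  | zero => simp only [runDeficit]; linarith
  | succ s ih =>
    have h3 := runDeficit_nonneg h0 (hpp.trans h2) s
    have h4 := mul_le_mul_of_nonneg_left ih (h0.le.trans hpp)
    have h5 := mul_nonneg (sub_nonneg.2 hpp) h3
    simp only [runDeficit]
    nlinarith

/-- Solves the recursion `stopGain_succ`. In this form the dependence on `p` can be estimated term
by term, since only the factors `cat` and `runDeficit` enter. -/
theorem stopGain_even_odd (hp : p ≠ 1) (k : ℕ) :
    stopGain p (2 * k + 2) =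
      1 - 2 * p - ∑ m ∈ Finset.range k, cat p (m + 1) * runDeficit p (2 * (k - m)) ∧
    stopGain p (2 * k + 3) =
      1 - 2 * p - ∑ m ∈ Finset.range k, cat p (m + 1) * runDeficit p (2 * (k - m) + 1) := by
  have hsum : ∀ k, ∑ m ∈ Finset.range k, cat p (m + 1) = catSum p (k + 1) - 1 := fun k => by
    rw [catSum, Finset.sum_range_succ', cat_zero, add_sub_cancel_right]
  have hodd : ∀ k, stopGain p (2 * k + 2) =
      1 - 2 * p - ∑ m ∈ Finset.range k, cat p (m + 1) * runDeficit p (2 * (k - m)) →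
      stopGain p (2 * k + 3) =
      1 - 2 * p - ∑ m ∈ Finset.range k, cat p (m + 1) * runDeficit p (2 * (k - m) + 1) := by
    intro k hk
    rw [stopGain_succ hp (2 * k + 1), hk, show (2 * k + 1) / 2 + 1 = k + 1 by omega,
      show (2 * k + 1 + 1) / 2 = k + 1 by omega]
    simp only [runDeficit, mul_add, Finset.sum_add_distrib, ← Finset.sum_mul, hsum]
    simp only [mul_left_comm _ p, ← Finset.mul_sum]
    ring
  induction k with
  | zero =>
    have : stopGain p (2 * 0 + 2) = 1 - 2 * p - ∑ m ∈ Finset.range 0,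
        cat p (m + 1) * runDeficit p (2 * (0 - m)) := by simpa using stopGain_two hp
    exact ⟨this, hodd 0 this⟩
  | succ k ih =>
    refine ⟨?_, hodd _ ?_⟩ <;>
    · rw [show 2 * (k + 1) + 2 = (2 * k + 2) + 2 by ring, stopGain_succ hp (2 * k + 2),
        show 2 * k + 2 + 1 = 2 * k + 3 by ring, ih.2, show (2 * k + 2) / 2 + 1 = k + 2 by omega,
        show (2 * k + 3) / 2 = k + 1 by omega, Finset.sum_range_succ, catSum_succ p (k + 1)]
      have : ∀ m ∈ Finset.range k, cat p (m + 1) * runDeficit p (2 * (k + 1 - m)) =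
          cat p (m + 1) * (p * runDeficit p (2 * (k - m) + 1) + p * (1 - 2 * p)) := by
        intro m hm
        rw [show 2 * (k + 1 - m) = 2 * (k - m) + 1 + 1 by have := Finset.mem_range.1 hm; omega]
        rfl
      rw [Finset.sum_congr rfl this, show 2 * (k + 1 - k) = 2 by omega]
      simp only [runDeficit, mul_add, Finset.sum_add_distrib, ← Finset.sum_mul, hsum]
      simp only [mul_left_comm _ p, ← Finset.mul_sum]
      ring

/-- A common form for even and odd arguments. -/
theorem exists_stopGain_eq {n : ℕ} (hn : 2 ≤ n) : ∃ (k : ℕ) (s : ℕ → ℕ), ∀ p : ℝ, p ≠ 1 →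
    stopGain p n = 1 - 2 * p - ∑ m ∈ Finset.range k, cat p (m + 1) * runDeficit p (s m) := by
  rcases Nat.even_or_odd' n with ⟨k, rfl | rfl⟩
  · obtain ⟨k, rfl⟩ := Nat.exists_eq_add_of_le' (show 1 ≤ k by omega)
    exact ⟨k, _, fun p hp => (stopGain_even_odd hp k).1⟩
  · obtain ⟨k, rfl⟩ := Nat.exists_eq_add_of_le' (show 1 ≤ k by omega)
    exact ⟨k, _, fun p hp => (stopGain_even_odd hp k).2⟩

theorem sum_cat_succ (p : ℝ) (k : ℕ) :
    ∑ m ∈ Finset.range k, cat p (m + 1) = catSum p (k + 1) - 1 := by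
  rw [catSum, Finset.sum_range_succ', cat_zero, add_sub_cancel_right]

/-- The term `1 - 2 p` falls at rate 2. The sum can fall at rate at most 2 times the total Catalan
weight without the zeroth term, and that weight is below 1 for `p ≤ 1 / 2`. -/
theorem stopGain_lt (h0 : 0 < p) (hpp : p < p') (h2 : p' ≤ 1 / 2) {n : ℕ} (hn : 2 ≤ n) :
    stopGain p' n < stopGain p n := by
  obtain ⟨k, s, hs⟩ := exists_stopGain_eq hn
  rw [hs p (by linarith), hs p' (by linarith)]
  have h3 : ∑ m ∈ Finset.range k, cat p (m + 1) * runDeficit p (s m) -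
      ∑ m ∈ Finset.range k, cat p' (m + 1) * runDeficit p' (s m) ≤
      2 * (p' - p) * ∑ m ∈ Finset.range k, cat p (m + 1) := by
    rw [← Finset.sum_sub_distrib, Finset.mul_sum]
    refine Finset.sum_le_sum fun m _ => ?_
    have h4 := mul_le_mul_of_nonneg_right (cat_le_cat h0 hpp.le h2 (m + 1))
      (runDeficit_nonneg (h0.trans hpp) h2 (s m))
    have h5 := mul_le_mul_of_nonneg_left (runDeficit_sub_le h0 hpp.le h2 (s m))
      (cat_pos h0 (by linarith) (m + 1)).le
    linarith
  have h6 : ∑ m ∈ Finset.range k, cat p (m + 1) < 1 := by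
    rw [sum_cat_succ]
    have h7 := catSum_lt h0 (by linarith) (k + 1)
    have h8 : 1 / (1 - p) ≤ 2 := by
      rw [div_le_iff₀ (by linarith)]
      linarith
    linarith
  have h9 := mul_lt_mul_of_pos_left h6 (show 0 < 2 * (p' - p) by linarith)
  linarith

/-- Dropping `p ^ (s + 1)` in `one_sub_mul_runDeficit` bounds each deficit below by -p(2p-1)/(1-p);
the bound 1/p on Catalan sums then finishes. -/
theorem stopGain_neg (h2 : 1 / 2 < p) (h1 : p < 1) {n : ℕ} (hn : 2 ≤ n) : stopGain p n < 0 := by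
  have h0 : 0 < p := by linarith
  have hq : 0 < 1 - p := sub_pos.2 h1
  obtain ⟨k, s, hs⟩ := exists_stopGain_eq hn
  rw [hs p h1.ne]
  have h3 : (1 - p) * -∑ m ∈ Finset.range k, cat p (m + 1) * runDeficit p (s m) ≤
      p * (2 * p - 1) * ∑ m ∈ Finset.range k, cat p (m + 1) := by
    rw [← Finset.sum_neg_distrib, Finset.mul_sum, Finset.mul_sum]
    refine Finset.sum_le_sum fun m _ => ?_
    have h4 := one_sub_mul_runDeficit p (s m)
    have h5 : 0 < cat p (m + 1) * p ^ (s m + 1) := mul_pos (cat_pos h0 h1 _) (by positivity)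
    linear_combination h5.le - cat p (m + 1) * h4
  rw [sum_cat_succ] at h3
  have h6 := catSum_lt' h0 h1 (k + 1)
  rw [lt_div_iff₀ h0] at h6
  have h7 : p * (2 * p - 1) * (catSum p (k + 1) - 1) < (2 * p - 1) * (1 - p) := by nlinarith
  nlinarith

theorem returnSum_le_returnSum (h0 : 0 < p) (hpp : p ≤ p') (h2 : p' ≤ 1 / 2) {x y : ℕ → ℝ} {n : ℕ}
    (hx : ∀ i < n, 0 ≤ x i) (hxy : ∀ i < n, x i ≤ y i) : returnSum p x n ≤ returnSum p' y n := by
  refine Finset.sum_le_sum fun i hi => ?_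
  have hi' : n - 2 - 2 * i < n := by have := Finset.mem_range.1 hi; omega
  have hr : 0 ≤ p * (1 - p) := mul_nonneg h0.le (by linarith)
  have hc := (cat_pos h0 (by linarith) i).le
  refine mul_le_mul (mul_le_mul (mul_one_sub_le hpp h2) (cat_le_cat h0 hpp h2 i) hc
    (hr.trans (mul_one_sub_le hpp h2))) (hxy _ hi') (hx _ hi') ?_
  exact mul_nonneg (hr.trans (mul_one_sub_le hpp h2)) (hc.trans (cat_le_cat h0 hpp h2 i))

theorem runSum_le_runSum (h0 : 0 < p) (hpp : p ≤ p') (h2 : p' ≤ 1 / 2) {x y : ℕ → ℝ} {n : ℕ}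
    (hx : ∀ i < n, 0 ≤ x i) (hxy : ∀ i < n, x i ≤ y i) : runSum p x n ≤ runSum p' y n := by
  induction n with
  | zero => exact le_rfl
  | succ n ih =>
    have hr : 0 ≤ p * (1 - p) := mul_nonneg h0.le (by linarith)
    refine add_le_add (mul_le_mul hpp (ih (fun i hi => hx i (by omega))
      fun i hi => hxy i (by omega)) (runSum_nonneg h0 (by linarith) fun i hi => hx i (by omega))
      (h0.le.trans hpp)) (mul_le_mul (mul_one_sub_le hpp h2) (hxy n n.lt_succ_self)
      (hx n n.lt_succ_self) (hr.trans (mul_one_sub_le hpp h2)))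

theorem kernel_le_kernel (h0 : 0 < p) (hpp : p ≤ p') (h2 : p' ≤ 1 / 2) {x y : ℕ → ℝ} {n : ℕ}
    (hx : ∀ i < n, 0 ≤ x i) (hxy : ∀ i < n, x i ≤ y i) : kernel p x n ≤ kernel p' y n :=
  add_le_add (runSum_le_runSum h0 hpp h2 (fun i hi => hx i (by omega)) fun i hi => hxy i (by omega))
    (returnSum_le_returnSum h0 hpp h2 hx hxy)

theorem kernel_one (p : ℝ) (x : ℕ → ℝ) : kernel p x 1 = 0 := by
  simp [kernel, runSum, returnSum]

theorem advantage_one (hp : p ≠ 1) : advantage p 1 = 1 - p := by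
  rw [advantage, kernel_one, stopGain_one hp, sub_zero]

theorem excess_one (h0 : 0 < p) (h1 : p < 1) : excess p 1 = 0 := by
  rw [excess_succ h0.le h1.le, zero_add, advantage_one h1.ne]
  exact max_eq_left (by linarith)

theorem excess_le_excess (h0 : 0 < p) (hpp : p ≤ p') (h2 : p' ≤ 1 / 2) (n : ℕ) :
    excess p n ≤ excess p' n := by
  induction n using Nat.strong_induction_on with
  | _ n ih =>
    match n with
    | 0 => rw [excess_zero, excess_zero]
    | 1 => rw [excess_one h0 (by linarith), excess_one (by linarith) (by linarith)]
    | n + 2 =>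
      rw [excess_succ h0.le (by linarith), excess_succ (by linarith) (by linarith)]
      refine max_le_max le_rfl (neg_le_neg ?_)
      have h3 : stopGain p' (n + 2) ≤ stopGain p (n + 2) := by
        rcases hpp.eq_or_lt with rfl | hlt
        · exact le_rfl
        · exact (stopGain_lt h0 hlt h2 (by omega)).le
      exact sub_le_sub h3 (kernel_le_kernel h0 hpp h2 (fun i _ => excess_nonneg p i) ih)

theorem advantage_lt (h0 : 0 < p) (hpp : p < p') (h2 : p' ≤ 1 / 2) {n : ℕ} (hn : 2 ≤ n) :
    advantage p' n < advantage p n := by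
  have h3 := stopGain_lt h0 hpp h2 hn
  have h4 := kernel_le_kernel (n := n) h0 hpp.le h2 (fun i _ => excess_nonneg p i)
    fun i _ => excess_le_excess h0 hpp.le h2 i
  rw [advantage, advantage]
  linarith

theorem advantage_neg (h2 : 1 / 2 < p) (h1 : p < 1) {n : ℕ} (hn : 2 ≤ n) : advantage p n < 0 :=
  sub_neg.2 ((stopGain_neg h2 h1 hn).trans_le
    (kernel_nonneg (by linarith) h1 fun i _ => excess_nonneg p i))

/-! ### Continuity in the parameter -/

theorem continuous_cat (n : ℕ) : Continuous fun p => cat p n := by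
  unfold cat
  fun_prop

theorem continuous_kernel {x : ℝ → ℕ → ℝ} (hx : ∀ n, Continuous fun p => x p n) (n : ℕ) :
    Continuous fun p => kernel p (x p) n := by
  have h1 : ∀ m, Continuous fun p => runSum p (x p) m := by
    intro m
    induction m with
    | zero => exact continuous_const
    | succ m ih =>
      simp only [runSum]
      have := hx m
      fun_prop
  refine (h1 _).add (continuous_finsetSum _ fun i _ => ?_)
  have h2 := continuous_cat i
  have h3 := hx (n - 2 - 2 * i)
  fun_prop

theorem continuous_surv (n k : ℕ) : Continuous fun p => surv p n k := by
  induction n generalizing k with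
  | zero => exact continuous_const
  | succ n ih =>
    cases k with
    | zero => exact continuous_const
    | succ k =>
      have h1 := ih k
      have h2 := ih (k + 2)
      simp only [surv]
      fun_prop

theorem continuous_stopVal (n j : ℕ) : Continuous fun p => stopVal p n j := by
  unfold stopVal
  split_ifs
  exacts [continuous_surv n 2, continuous_const]

theorem continuous_val (n j : ℕ) : Continuous fun p => val p n j := by
  induction n generalizing j with
  | zero => exact continuous_stopVal 0 j
  | succ n ih =>
    have h1 := ih (j - 1)
    have h2 := ih (j + 1)
    have h3 := continuous_stopVal (n + 1) j
    simp only [val]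
    fun_prop

theorem continuous_excess (n : ℕ) : Continuous fun p => excess p n :=
  (continuous_val n 1).sub (continuous_surv n 2)

theorem continuous_stopGain (n : ℕ) : Continuous fun p => stopGain p n :=
  ((continuous_surv n 2).sub (continuous_pow n)).sub
    (continuous_kernel (fun m => continuous_surv m 2) n)

theorem continuous_advantage (n : ℕ) : Continuous fun p => advantage p n :=
  (continuous_stopGain n).sub (continuous_kernel continuous_excess n)

/-! ### Small parameters -/

theorem cat_succ_le (h0 : 0 < p) (h1 : p < 1) (n : ℕ) : cat p (n + 1) ≤ cat p n := by
  have h2 := cat_succ p n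
  have h3 := cat_pos h0 h1 n
  have h4 : p * (1 - p) ≤ 1 / 4 := by nlinarith [sq_nonneg (p - 1 / 2)]
  have h5 : p * (1 - p) * ((2 * n + 1) * cat p n) ≤ 1 / 4 * ((2 * n + 1) * cat p n) :=
    mul_le_mul_of_nonneg_right h4 (by positivity)
  have h6 : ((n : ℝ) + 2) * cat p (n + 1) ≤ (n + 2) * cat p n := by nlinarith
  exact le_of_mul_le_mul_left h6 (by positivity)

theorem cat_antitone (h0 : 0 < p) (h1 : p < 1) : Antitone (cat p) :=
  antitone_nat_of_succ_le (cat_succ_le h0 h1)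

theorem cat_two (p : ℝ) : cat p 2 = 2 * (p * (1 - p)) ^ 2 := by simp [cat, catalan_two]

theorem cat_three (p : ℝ) : cat p 3 = 5 * (p * (1 - p)) ^ 3 := by simp [cat, catalan_three]

theorem stopGain_odd_eq (hp : p ≠ 1) (k : ℕ) : stopGain p (2 * k + 3) =
    p * stopGain p (2 * k + 2) + (1 - 2 * p) * (1 - p * catSum p (k + 1)) := by
  rw [stopGain_succ hp (2 * k + 1), show (2 * k + 1) / 2 + 1 = k + 1 by omega,
    show (2 * k + 1 + 1) / 2 = k + 1 by omega]
  ring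

theorem stopGain_even_eq (hp : p ≠ 1) (k : ℕ) : stopGain p (2 * k + 4) =
    p * stopGain p (2 * k + 3) + (1 - 2 * p) * (1 - p * catSum p (k + 1)) -
      p * (1 - p) * cat p (k + 1) := by
  rw [stopGain_succ hp (2 * k + 2), show (2 * k + 2) / 2 + 1 = k + 2 by omega,
    show (2 * k + 2 + 1) / 2 = k + 1 by omega, catSum_succ p (k + 1)]
  ring

theorem stopGain_four (hp : p ≠ 1) : stopGain p 4 = 1 - 2 * p - (p * (1 - p)) ^ 2 := by
  have h1 := stopGain_odd_eq hp 0
  have h2 := stopGain_even_eq hp 0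
  norm_num [stopGain_two hp, cat_one] at h1 h2
  rw [h2, h1]
  ring

theorem cat_four (p : ℝ) : cat p 4 = 14 * (p * (1 - p)) ^ 4 := by
  have h := cat_succ p 3
  rw [cat_three] at h
  norm_num at h
  linear_combination h / 5

theorem cat_five (p : ℝ) : cat p 5 = 42 * (p * (1 - p)) ^ 5 := by
  have h := cat_succ p 4
  rw [cat_four] at h
  norm_num at h
  linear_combination h / 6

/-- The parameter lies just above p_4, where `stopGain` is still nonnegative from n = 5 on. The even
terms are propagated by a two-step recursion, and each odd term follows from the preceding even one.
-/
theorem stopGain_nonneg_aux (k : ℕ) :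
    0 ≤ stopGain (46899 / 100000) (2 * k + 5) ∧ 0 ≤ stopGain (46899 / 100000) (2 * k + 6) := by
  set p : ℝ := 46899 / 100000 with hp
  have hp1 : p ≠ 1 := by norm_num [hp]
  have h0 : 0 < p := by norm_num [hp]
  have h1 : p < 1 := by norm_num [hp]
  have hS : ∀ n, 0 ≤ 1 - p * catSum p n := fun n => by
    have := catSum_lt' h0 h1 n
    rw [lt_div_iff₀ h0] at this
    linarith
  have hmu : 0 ≤ 1 - 2 * p := by norm_num [hp]
  have hodd : ∀ k, 0 ≤ stopGain p (2 * k + 2) → 0 ≤ stopGain p (2 * k + 3) := fun k hk => by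
    rw [stopGain_odd_eq hp1]
    exact add_nonneg (mul_nonneg h0.le hk) (mul_nonneg hmu (hS _))
  have heven : ∀ k, stopGain p (2 * k + 4) = p ^ 2 * stopGain p (2 * k + 2) +
      ((1 + p) * (1 - 2 * p) * (1 - p * catSum p (k + 1)) - p * (1 - p) * cat p (k + 1)) := by
    intro k
    rw [stopGain_even_eq hp1, stopGain_odd_eq hp1]
    ring
  have hpos : ∀ k, 2 ≤ k →
      0 ≤ (1 + p) * (1 - 2 * p) * (1 - p * catSum p (k + 1)) - p * (1 - p) * cat p (k + 1) := by
    intro k hk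
    rcases lt_or_ge k 4 with hk4 | hk4
    · have : k = 2 ∨ k = 3 := by omega
      rcases this with rfl | rfl <;>
      norm_num [catSum_succ, cat_one, cat_two, cat_three, cat_four, hp]
    -- Uniform in `k`: the Catalan weight is at most `cat p 5`, and `1 - p * catSum` is at least
    -- (1-2p)/(1-p).
    · have h2 := cat_antitone h0 h1 (show 5 ≤ k + 1 by omega)
      rw [cat_five] at h2
      have h3 := catSum_le h0 h1 (k + 1)
      norm_num [hp] at h2 h3 ⊢
      linarith
  have h4 : stopGain p 4 = 1 - 2 * p - (p * (1 - p)) ^ 2 := stopGain_four hp1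
  have h5 : 0 ≤ stopGain p 5 := by
    have := stopGain_odd_eq hp1 1
    norm_num at this
    rw [this, h4]
    norm_num [catSum_succ, cat_one, hp]
  -- Computed directly, because `stopGain p 4` is slightly negative here and cannot start the
  -- induction.
  have h6 : 0 ≤ stopGain p 6 := by
    have := heven 1
    norm_num at this
    rw [this, h4]
    norm_num [catSum_succ, cat_one, cat_two, hp]
  induction k with
  | zero => exact ⟨h5, h6⟩
  | succ k ih =>
    refine ⟨hodd (k + 2) ih.2, ?_⟩
    have := heven (k + 2)
    rw [show 2 * (k + 1) + 6 = 2 * (k + 2) + 4 by ring, this]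
    exact add_nonneg (mul_nonneg (by positivity) ih.2) (hpos _ (by omega))

theorem stopGain_nonneg (h0 : 0 < p) (h1 : p ≤ 46899 / 100000) {n : ℕ} (hn : 1 ≤ n) (h4 : n ≠ 4) :
    0 ≤ stopGain p n := by
  have hp : p ≠ 1 := by linarith
  match n, hn, h4 with
  | 1, _, _ => rw [stopGain_one hp]; linarith
  | 2, _, _ => rw [stopGain_two hp]; linarith
  | 3, _, _ =>
    have := stopGain_odd_eq hp 0
    norm_num [stopGain_two hp] at this
    rw [this]
    nlinarith
  | n + 5, _, _ =>
    have h5 : 0 ≤ stopGain (46899 / 100000) (n + 5) := by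
      rcases Nat.even_or_odd' n with ⟨k, rfl | rfl⟩
      exacts [(stopGain_nonneg_aux k).1, (stopGain_nonneg_aux k).2]
    rcases h1.eq_or_lt with rfl | h1
    · exact h5
    · exact h5.trans (stopGain_lt h0 h1 (by norm_num) (by omega)).le

theorem advantage_nonneg_of_four (h0 : 0 < p) (h1 : p ≤ 46899 / 100000)
    (h4 : 0 ≤ stopGain p 4) {n : ℕ} (hn : 1 ≤ n) : 0 ≤ advantage p n := by
  have hE : ∀ n, 1 ≤ n → 0 ≤ stopGain p n := fun n hn => by
    rcases eq_or_ne n 4 with rfl | h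
    exacts [h4, stopGain_nonneg h0 h1 hn h]
  have hw : ∀ n, excess p n = 0 := by
    intro n
    induction n using Nat.strong_induction_on with
    | _ n ih =>
      cases n with
      | zero => exact excess_zero p
      | succ n =>
        rw [excess_succ h0.le (by linarith), advantage, kernel_congr p (y := fun _ => 0) ih]
        refine max_eq_left ?_
        have h2 := kernel_nonneg h0 (by linarith) (x := fun _ => 0) (n := n + 1) fun i _ => le_rfl
        have h3 := kernel_add p (fun _ => 0) (fun _ => 0) (n + 1)
        simp only [add_zero] at h3
        linarith [hE (n + 1) (by omega)]
  have h3 := kernel_add p (fun _ => 0) (fun _ => 0) n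
  simp only [add_zero] at h3
  rw [advantage, kernel_congr p (y := fun _ => 0) fun i _ => hw i]
  linarith [hE n hn]

theorem excess_eq_zero_of_lt_four (h0 : 0 < p) (h2 : p ≤ 1 / 2) {n : ℕ} (hn : n < 4) :
    excess p n = 0 := by
  have hp : p ≠ 1 := by linarith
  have e0 := excess_zero p
  have e1 := excess_one h0 (by linarith)
  have e2 : excess p 2 = 0 := by
    rw [excess_succ h0.le (by linarith), advantage, stopGain_two hp]
    simp [kernel, runSum, returnSum, e0]
    linarith
  have e3 : excess p 3 = 0 := by
    have := stopGain_odd_eq hp 0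
    norm_num [stopGain_two hp] at this
    rw [excess_succ h0.le (by linarith), advantage, this]
    simp [kernel, runSum, returnSum, e0, e1]
    nlinarith
  interval_cases n <;> assumption

theorem kernel_excess_four (h0 : 0 < p) (h2 : p ≤ 1 / 2) : kernel p (excess p) 4 = 0 := by
  rw [kernel_congr p (y := fun _ => 0) fun i hi => excess_eq_zero_of_lt_four h0 h2 hi]
  simp [kernel, runSum, returnSum]

theorem advantage_four (h0 : 0 < p) (h2 : p ≤ 1 / 2) :
    advantage p 4 = 1 - 2 * p - (p * (1 - p)) ^ 2 := by
  rw [advantage, kernel_excess_four h0 h2, sub_zero, stopGain_four (by linarith)]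

/-! ### Critical values -/

theorem criticalValue_eq {n : ℕ} (hn : 1 ≤ n) :
    criticalValue n = sSup {x : ℝ | (0 < x ∧ x < 1) ∧ 0 ≤ advantage x n} := by
  rw [criticalValue]
  congr 1
  ext x
  constructor
  · rintro ⟨p, rfl, h0, h1, h⟩
    exact ⟨⟨h0, h1⟩, (optimalToStop_iff_advantage hn).1 h⟩
  · rintro ⟨⟨h0, h1⟩, h⟩
    exact ⟨⟨x, h0.le, h1.le⟩, rfl, h0, h1, (optimalToStop_iff_advantage hn).2 h⟩

theorem criticalValue_one : criticalValue 1 = 1 := by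
  rw [criticalValue_eq le_rfl]
  have : {x : ℝ | (0 < x ∧ x < 1) ∧ 0 ≤ advantage x 1} = Set.Ioo 0 1 := by
    ext x
    simp only [Set.mem_ofPred_eq, Set.mem_Ioo, and_iff_left_iff_imp]
    rintro ⟨-, h1⟩
    rw [advantage_one h1.ne]
    linarith
  rw [this, csSup_Ioo zero_lt_one]

theorem criticalValue_spec {n : ℕ} (hn : 2 ≤ n) :
    0 < criticalValue n ∧ criticalValue n ≤ 1 / 2 ∧
      ∀ x, 0 < x → x < 1 → (0 ≤ advantage x n ↔ x ≤ criticalValue n) := by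
  rw [criticalValue_eq (by omega)]
  set C : Set ℝ := {x : ℝ | (0 < x ∧ x < 1) ∧ 0 ≤ advantage x n}
  have hub : ∀ x ∈ C, x ≤ 1 / 2 := fun x hx => by
    by_contra h
    exact (advantage_neg (not_le.1 h) hx.1.2 hn).not_ge hx.2
  have hbdd : BddAbove C := ⟨1 / 2, hub⟩
  -- Any parameter below p_4 would do: stopping is optimal there for every `n`.
  have hmem : (0.46 : ℝ) ∈ C := by
    refine ⟨by norm_num, advantage_nonneg_of_four (by norm_num) (by norm_num) ?_ (by omega)⟩
    rw [stopGain_four (by norm_num)]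
    norm_num
  have hpos : 0 < sSup C := lt_of_lt_of_le (by norm_num) (le_csSup hbdd hmem)
  have hle : sSup C ≤ 1 / 2 := csSup_le ⟨_, hmem⟩ hub
  have hadv : 0 ≤ advantage (sSup C) n := by
    have hcl : IsClosed {x : ℝ | 0 ≤ advantage x n} :=
      isClosed_le continuous_const (continuous_advantage n)
    exact hcl.closure_subset_iff.2 (fun x hx => hx.2) (csSup_mem_closure ⟨_, hmem⟩ hbdd)
  refine ⟨hpos, hle, fun x hx0 hx1 => ⟨fun h => le_csSup hbdd ⟨⟨hx0, hx1⟩, h⟩, fun h => ?_⟩⟩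
  rcases h.eq_or_lt with rfl | h
  · exact hadv
  · exact hadv.trans (advantage_lt hx0 h hle hn).le

theorem optimalToStop_iff_le_criticalValue {n : ℕ} (hn : 1 ≤ n) {p : I} (h0 : 0 < (p : ℝ))
    (h1 : (p : ℝ) < 1) : OptimalToStop p n 1 ↔ (p : ℝ) ≤ criticalValue n := by
  rw [optimalToStop_iff_advantage hn]
  rcases hn.eq_or_lt with rfl | hn
  · rw [criticalValue_one, advantage_one h1.ne]
    exact ⟨fun _ => h1.le, fun _ => by linarith⟩
  · exact (criticalValue_spec hn).2.2 p h0 h1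

theorem criticalValue_four_bounds :
    (0.468989 : ℝ) ≤ criticalValue 4 ∧ criticalValue 4 < (0.468990 : ℝ) := by
  obtain ⟨-, -, h⟩ := criticalValue_spec (n := 4) (by norm_num)
  refine ⟨(h _ (by norm_num) (by norm_num)).1 ?_, not_le.1 fun hle => ?_⟩
  · rw [advantage_four (by norm_num) (by norm_num)]
    norm_num
  · have := (h _ (by norm_num) (by norm_num)).2 hle
    rw [advantage_four (by norm_num) (by norm_num)] at this
    norm_num at this

theorem criticalValue_four_le {n : ℕ} (hn : 1 ≤ n) : criticalValue 4 ≤ criticalValue n := by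
  obtain ⟨h0, h2, h⟩ := criticalValue_spec (n := 4) (by norm_num)
  rcases hn.eq_or_lt with rfl | hn'
  · rw [criticalValue_one]
    linarith
  · have h4 := (h _ h0 (by linarith)).2 le_rfl
    rw [advantage, kernel_excess_four h0 h2, sub_zero] at h4
    refine ((criticalValue_spec hn').2.2 _ h0 (by linarith)).1
      (advantage_nonneg_of_four h0 ?_ h4 hn)
    linarith [criticalValue_four_bounds.2]

end

/-! ### The rule that continues until three steps remain -/

section

variable {p : ℝ}

/-- The gain over stopping at once in the state `(2 n + 4, 1)`, if the walk is stopped only when at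
most three steps remain. -/
noncomputable def evenGain (p : ℝ) (n : ℕ) : ℝ :=
  (1 - p) * (catSum p (n + 2) - 1) -
    (1 - p) ^ 2 * ((catSum p (n + 3) - 1) / (p * (1 - p)) - catSum p (n + 2)) -
    (1 - 2 * p) * (1 - 2 * (1 - p) * catSum p (n + 1) +
      (2 - p) / p * (catSum p (n + 2) - 1) +
      (catSum p (n + 3) - 1) / (p * (1 - p)) - catSum p (n + 2))

/-- The gain over stopping at once in the state `(2 n + 3, 1)`, if the walk is stopped only when at
most three steps remain. -/
noncomputable def oddGain (p : ℝ) (n : ℕ) : ℝ :=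
  (2 - p) * (catSum p (n + 2) - 1) -
    (1 - p) * ((catSum p (n + 3) - 1) / (p * (1 - p)) - catSum p (n + 2)) -
    p * (1 - p) * catSum p (n + 1) +
    (1 - 2 * p) * ((1 - 2 * p) / p + (2 - (1 - p) ^ 2 / p) * catSum p (n + 1) - p * catSum p n -
      (1 / p + 1 / (p * (1 - p))) * (catSum p (n + 2) - 1))

/-- The gain over stopping at once in the state `(n, 1)`, if the walk is stopped only when at
most three steps remain. -/
noncomputable def gain (p : ℝ) (n : ℕ) : ℝ :=
  if n < 4 then 0 else if Even n then evenGain p (n / 2 - 2) else oddGain p (n / 2 - 1)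

theorem gain_even (p : ℝ) (n : ℕ) : gain p (2 * n + 4) = evenGain p n := by
  rw [gain, if_neg (by omega), if_pos (by simp [parity_simps]), show (2 * n + 4) / 2 - 2 = n by omega]

theorem catSum_two (p : ℝ) : catSum p 2 = 1 + p * (1 - p) := by
  rw [catSum_succ, catSum_one, cat_one]

theorem catSum_three (p : ℝ) : catSum p 3 = 1 + p * (1 - p) + 2 * (p * (1 - p)) ^ 2 := by
  rw [catSum_succ, catSum_two, cat_two]

theorem oddGain_zero (h0 : p ≠ 0) (h1 : p ≠ 1) : oddGain p 0 = 0 := by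
  have hq : 1 - p ≠ 0 := sub_ne_zero.2 h1.symm
  simp only [oddGain, zero_add, catSum_zero, catSum_one, catSum_two, catSum_three]
  field_simp
  ring

/-- As `oddGain p 0 = 0`, the closed form also covers the state with three steps left, where the
rule already stops. -/
theorem gain_odd (h0 : p ≠ 0) (h1 : p ≠ 1) (n : ℕ) : gain p (2 * n + 3) = oddGain p n := by
  cases n with
  | zero => rw [oddGain_zero h0 h1]; simp [gain]
  | succ n =>
    rw [gain, if_neg (by omega), if_neg (by simp [parity_simps]),
      show (2 * (n + 1) + 3) / 2 - 1 = n + 1 by omega]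

theorem gain_of_lt {n : ℕ} (hn : n < 4) : gain p n = 0 := if_pos hn

/-! ### Recursions for the explicit gains -/

/-- Convolution with the weights of the excursions. -/
noncomputable def catConv (p : ℝ) (f : ℕ → ℝ) (n : ℕ) : ℝ :=
  ∑ i ∈ Finset.range n, p * (1 - p) * cat p i * f (n - 1 - i)

theorem catConv_catSum_succ (p : ℝ) (n : ℕ) :
    catConv p (fun i => catSum p (i + 1)) n = catSum p (n + 1) - 1 := by
  rw [← catSum_conv, catConv]
  refine Finset.sum_congr rfl fun i hi => ?_
  rw [show n - 1 - i + 1 = n - i by have := Finset.mem_range.1 hi; omega]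

theorem catConv_catSum (p : ℝ) (n : ℕ) :
    catConv p (fun i => catSum p i) (n + 1) = catSum p (n + 1) - 1 := by
  rw [← catSum_conv, catConv, Finset.sum_range_succ]
  simp

theorem catConv_catSum_add_two (p : ℝ) (n : ℕ) :
    catConv p (fun i => catSum p (i + 2)) n = catSum p (n + 2) - 1 - p * (1 - p) * cat p n := by
  rw [← catConv_catSum_succ, catConv, catConv, Finset.sum_range_succ]
  simp only [Nat.add_sub_cancel, Nat.sub_self, zero_add, catSum_one, mul_one, add_sub_cancel_right]
  refine Finset.sum_congr rfl fun i hi => ?_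
  rw [show n - 1 - i + 2 = n - i + 1 by have := Finset.mem_range.1 hi; omega]

theorem catConv_catSum_add_three (p : ℝ) (n : ℕ) :
    catConv p (fun i => catSum p (i + 3)) n = catSum p (n + 3) - 1 - p * (1 - p) * cat p (n + 1) -
      p * (1 - p) * (1 + p * (1 - p)) * cat p n := by
  rw [← catConv_catSum_add_two, catConv, catConv, Finset.sum_range_succ]
  simp only [Nat.add_sub_cancel, Nat.sub_self, zero_add, catSum_two]
  rw [eq_sub_iff_add_eq]
  congr 1
  · refine Finset.sum_congr rfl fun i hi => ?_
    rw [show n - 1 - i + 3 = n - i + 2 by have := Finset.mem_range.1 hi; omega]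
  · ring

theorem catConv_const (p c : ℝ) (n : ℕ) :
    catConv p (fun _ => c) n = p * (1 - p) * c * catSum p n := by
  rw [catConv, catSum, Finset.mul_sum]
  exact Finset.sum_congr rfl fun i _ => by ring

theorem catConv_add (p : ℝ) (f g : ℕ → ℝ) (n : ℕ) :
    catConv p (fun i => f i + g i) n = catConv p f n + catConv p g n := by
  simp only [catConv, mul_add, Finset.sum_add_distrib]

theorem catConv_mul (p c : ℝ) (f : ℕ → ℝ) (n : ℕ) :
    catConv p (fun i => c * f i) n = c * catConv p f n := by
  simp only [catConv, Finset.mul_sum]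
  exact Finset.sum_congr rfl fun i _ => by ring

theorem catConv_linear_combination (p c₀ c₁ c₂ c₃ c₄ : ℝ) (n : ℕ) :
    catConv p (fun i => c₀ + (c₁ * catSum p i + (c₂ * catSum p (i + 1) + (c₃ * catSum p (i + 2) +
      c₄ * catSum p (i + 3))))) (n + 1) =
    c₀ * (p * (1 - p) * catSum p (n + 1)) + c₁ * (catSum p (n + 1) - 1) +
      c₂ * (catSum p (n + 2) - 1) + c₃ * (catSum p (n + 3) - 1 - p * (1 - p) * cat p (n + 1)) +
      c₄ * (catSum p (n + 4) - 1 - p * (1 - p) * cat p (n + 2) -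
        p * (1 - p) * (1 + p * (1 - p)) * cat p (n + 1)) := by
  rw [catConv_add, catConv_add, catConv_add, catConv_add, catConv_const, catConv_mul, catConv_mul,
    catConv_mul, catConv_mul, catConv_catSum, catConv_catSum_succ, catConv_catSum_add_two,
    catConv_catSum_add_three]
  ring

theorem catConv_evenGain (p : ℝ) (n : ℕ) : catConv p (evenGain p) n =
    (-(1 - p) + (1 - p) ^ 2 / (p * (1 - p)) - (1 - 2 * p) * (1 - (2 - p) / p - 1 / (p * (1 - p)))) *
      (p * (1 - p) * catSum p n) +
    2 * (1 - p) * (1 - 2 * p) * (catSum p (n + 1) - 1) +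
    ((1 - p) + (1 - p) ^ 2 - (1 - 2 * p) * ((2 - p) / p - 1)) *
      (catSum p (n + 2) - 1 - p * (1 - p) * cat p n) -
    ((1 - p) ^ 2 + (1 - 2 * p)) / (p * (1 - p)) *
      (catSum p (n + 3) - 1 - p * (1 - p) * cat p (n + 1) -
        p * (1 - p) * (1 + p * (1 - p)) * cat p n) := by
  have : evenGain p = fun i =>
      (-(1 - p) + (1 - p) ^ 2 / (p * (1 - p)) -
        (1 - 2 * p) * (1 - (2 - p) / p - 1 / (p * (1 - p)))) +
      (2 * (1 - p) * (1 - 2 * p) * catSum p (i + 1) +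
      (((1 - p) + (1 - p) ^ 2 - (1 - 2 * p) * ((2 - p) / p - 1)) * catSum p (i + 2) +
      (-(((1 - p) ^ 2 + (1 - 2 * p)) / (p * (1 - p)))) * catSum p (i + 3))) := by
    funext i
    simp only [evenGain]
    ring
  rw [this, catConv_add, catConv_add, catConv_add, catConv_const, catConv_mul, catConv_mul,
    catConv_mul, catConv_catSum_succ, catConv_catSum_add_two, catConv_catSum_add_three]
  ring

theorem catConv_oddGain (p : ℝ) (n : ℕ) : catConv p (oddGain p) (n + 1) =
    (-(2 - p) + (1 - p) / (p * (1 - p)) +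
        (1 - 2 * p) * ((1 - 2 * p) / p + (1 / p + 1 / (p * (1 - p))))) *
      (p * (1 - p) * catSum p (n + 1)) -
    (1 - 2 * p) * p * (catSum p (n + 1) - 1) +
    (-(p * (1 - p)) + (1 - 2 * p) * (2 - (1 - p) ^ 2 / p)) * (catSum p (n + 2) - 1) +
    (2 - p + (1 - p) - (1 - 2 * p) * (1 / p + 1 / (p * (1 - p)))) *
      (catSum p (n + 3) - 1 - p * (1 - p) * cat p (n + 1)) -
    (1 - p) / (p * (1 - p)) *
      (catSum p (n + 4) - 1 - p * (1 - p) * cat p (n + 2) -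
        p * (1 - p) * (1 + p * (1 - p)) * cat p (n + 1)) := by
  have : oddGain p = fun i =>
      (-(2 - p) + (1 - p) / (p * (1 - p)) +
        (1 - 2 * p) * ((1 - 2 * p) / p + (1 / p + 1 / (p * (1 - p))))) +
      ((-((1 - 2 * p) * p)) * catSum p i +
      ((-(p * (1 - p)) + (1 - 2 * p) * (2 - (1 - p) ^ 2 / p)) * catSum p (i + 1) +
      ((2 - p + (1 - p) - (1 - 2 * p) * (1 / p + 1 / (p * (1 - p)))) * catSum p (i + 2) +
      (-((1 - p) / (p * (1 - p)))) * catSum p (i + 3)))) := by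
    funext i
    simp only [oddGain]
    ring
  rw [this, catConv_linear_combination]
  ring

/-- This and `evenGain_succ` are `kernel_succ` combined with the recursion of `stopGain`, written
for the closed forms; with them the closed forms are verified rather than derived. -/
theorem oddGain_succ (h0 : p ≠ 0) (h1 : p ≠ 1) (n : ℕ) :
    oddGain p (n + 1) = p * evenGain p n + p * (1 - p) * oddGain p n +
      catConv p (oddGain p) (n + 1) - p * catConv p (evenGain p) n -
      (1 - 2 * p) * (1 - p * catSum p (n + 2)) := by
  have hq : 1 - p ≠ 0 := sub_ne_zero.2 h1.symm
  rw [catConv_evenGain, catConv_oddGain, evenGain, oddGain, oddGain]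
  simp only [show n + 1 + 1 = n + 2 by rfl, show n + 1 + 2 = n + 3 by rfl,
    show n + 1 + 3 = n + 4 by rfl, catSum_succ p (n + 3), catSum_succ p (n + 2),
    catSum_succ p (n + 1), catSum_succ p n]
  field_simp
  ring

theorem evenGain_succ (h0 : p ≠ 0) (h1 : p ≠ 1) (n : ℕ) :
    evenGain p (n + 1) = p * oddGain p (n + 1) + p * (1 - p) * evenGain p n +
      catConv p (evenGain p) (n + 1) - p * catConv p (oddGain p) (n + 1) -
      ((1 - 2 * p) * (1 - p * catSum p (n + 2)) - p * (1 - p) * cat p (n + 2)) := by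
  have hq : 1 - p ≠ 0 := sub_ne_zero.2 h1.symm
  rw [catConv_evenGain, catConv_oddGain, evenGain, oddGain, evenGain]
  simp only [show n + 1 + 1 = n + 2 by rfl, show n + 1 + 2 = n + 3 by rfl,
    show n + 1 + 3 = n + 4 by rfl, catSum_succ p (n + 3), catSum_succ p (n + 2),
    catSum_succ p (n + 1), catSum_succ p n]
  field_simp
  ring

theorem returnSum_gain_even (n : ℕ) :
    returnSum p (gain p) (2 * n + 4) = catConv p (evenGain p) n := by
  rw [returnSum, show (2 * n + 4) / 2 = n + 1 + 1 by omega, Finset.sum_range_succ,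
    Finset.sum_range_succ, gain_of_lt (by omega), gain_of_lt (by omega), mul_zero, mul_zero,
    add_zero, add_zero, catConv]
  refine Finset.sum_congr rfl fun i hi => ?_
  rw [show 2 * n + 4 - 2 - 2 * i = 2 * (n - 1 - i) + 4 by have := Finset.mem_range.1 hi; omega,
    gain_even]

theorem returnSum_gain_odd (h0 : p ≠ 0) (h1 : p ≠ 1) (n : ℕ) :
    returnSum p (gain p) (2 * n + 5) = catConv p (oddGain p) (n + 1) := by
  rw [returnSum, show (2 * n + 5) / 2 = n + 1 + 1 by omega, Finset.sum_range_succ,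
    gain_of_lt (by omega), mul_zero, add_zero, catConv]
  refine Finset.sum_congr rfl fun i hi => ?_
  rw [show 2 * n + 5 - 2 - 2 * i = 2 * (n + 1 - 1 - i) + 3 by
    have := Finset.mem_range.1 hi; omega, gain_odd h0 h1]

theorem evenGain_zero (h0 : p ≠ 0) (h1 : p ≠ 1) :
    evenGain p 0 = (p * (1 - p)) ^ 2 - (1 - 2 * p) := by
  have hq : 1 - p ≠ 0 := sub_ne_zero.2 h1.symm
  simp only [evenGain, zero_add, catSum_one, catSum_two, catSum_three]
  field_simp
  ring

theorem kernel_gain_sub (h0 : p ≠ 0) (h1 : p ≠ 1) (n : ℕ) :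
    kernel p (gain p) (2 * n + 4) - stopGain p (2 * n + 4) = gain p (2 * n + 4) ∧
      kernel p (gain p) (2 * n + 5) - stopGain p (2 * n + 5) = gain p (2 * n + 5) := by
  have hodd : ∀ n, kernel p (gain p) (2 * n + 4) - stopGain p (2 * n + 4) = gain p (2 * n + 4) →
      kernel p (gain p) (2 * n + 5) - stopGain p (2 * n + 5) = gain p (2 * n + 5) := by
    intro n hn
    have h2 := kernel_succ p (gain p) (2 * n + 3)
    have h3 := stopGain_odd_eq h1 (n + 1)
    rw [show 2 * (n + 1) + 3 = 2 * n + 5 by ring, show 2 * (n + 1) + 2 = 2 * n + 4 by ring] at h3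
    rw [show 2 * n + 3 + 2 = 2 * n + 5 by ring, show 2 * n + 3 + 1 = 2 * n + 4 by ring,
      returnSum_gain_even, returnSum_gain_odd h0 h1, gain_odd h0 h1] at h2
    rw [gain_even] at hn
    rw [show gain p (2 * n + 5) = oddGain p (n + 1) from gain_odd h0 h1 (n + 1),
      oddGain_succ h0 h1, h2, h3, ← hn, show n + 1 + 1 = n + 2 by rfl]
    ring
  induction n with
  | zero =>
    refine ⟨?_, hodd 0 ?_⟩ <;>
    · have h2 : kernel p (gain p) 4 = kernel p (fun _ => 0) 4 :=
        kernel_congr p fun i hi => gain_of_lt hi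
      rw [gain_even, evenGain_zero h0 h1, mul_zero, zero_add, h2, stopGain_four h1]
      simp [kernel, runSum, returnSum]
  | succ n ih =>
    refine ⟨?_, hodd _ ?_⟩ <;>
    · have h2 := kernel_succ p (gain p) (2 * n + 4)
      have h3 := stopGain_even_eq h1 (n + 1)
      have h4 := returnSum_gain_even (p := p) (n + 1)
      rw [show 2 * (n + 1) + 4 = 2 * n + 6 by ring] at h3 h4
      rw [show 2 * (n + 1) + 3 = 2 * n + 5 by ring] at h3
      have h5 := ih.2
      rw [show 2 * n + 4 + 2 = 2 * n + 6 by ring, show 2 * n + 4 + 1 = 2 * n + 5 by ring,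
        returnSum_gain_odd h0 h1, h4, gain_even] at h2
      rw [show gain p (2 * n + 5) = oddGain p (n + 1) from gain_odd h0 h1 (n + 1)] at h5
      rw [gain_even, evenGain_succ h0 h1, show 2 * (n + 1) + 4 = 2 * n + 6 by ring, h2, h3, ← h5,
        show n + 1 + 1 = n + 2 by rfl]
      ring

theorem gain_eq (h0 : p ≠ 0) (h1 : p ≠ 1) {n : ℕ} (hn : 4 ≤ n) :
    gain p n = kernel p (gain p) n - stopGain p n := by
  rcases Nat.even_or_odd' n with ⟨k, rfl | rfl⟩
  · obtain ⟨k, rfl⟩ := Nat.exists_eq_add_of_le' (show 2 ≤ k by omega)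
    exact ((kernel_gain_sub h0 h1 k).1).symm
  · obtain ⟨k, rfl⟩ := Nat.exists_eq_add_of_le' (show 2 ≤ k by omega)
    exact ((kernel_gain_sub h0 h1 k).2).symm

/-! ### The explicit rule against the optimal one -/

theorem gain_le_excess (h0 : 0 < p) (h1 : p < 1) (n : ℕ) : gain p n ≤ excess p n := by
  induction n using Nat.strong_induction_on with
  | _ n ih =>
    rcases lt_or_ge n 4 with hn | hn
    · rw [gain_of_lt hn]
      exact excess_nonneg p n
    · obtain ⟨m, rfl⟩ := Nat.exists_eq_add_of_le' (show 1 ≤ n by omega)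
      rw [excess_succ h0.le h1.le, gain_eq h0.ne' h1.ne hn, advantage]
      exact le_max_of_le_right (by linarith [kernel_mono h0 h1 ih])

theorem advantage_le_neg_gain (h0 : 0 < p) (h1 : p < 1) {n : ℕ} (hn : 4 ≤ n) :
    advantage p n ≤ -gain p n := by
  rw [gain_eq h0.ne' h1.ne hn, advantage]
  linarith [kernel_mono h0 h1 (n := n) fun i _ => gain_le_excess h0 h1 i]

/-- While continuing never hurts, the positive part in `excess_succ` is inactive and both sequences
obey the same recursion. -/
theorem excess_eq_gain (h0 : 0 < p) (h2 : p ≤ 1 / 2) {n : ℕ} (hx : ∀ i < n, 0 ≤ gain p i) :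
    ∀ i < n, excess p i = gain p i := by
  intro i
  induction i using Nat.strong_induction_on with
  | _ i ih =>
    intro hi
    rcases lt_or_ge i 4 with h | h
    · rw [gain_of_lt h, excess_eq_zero_of_lt_four h0 h2 h]
    · obtain ⟨m, rfl⟩ := Nat.exists_eq_add_of_le' (show 1 ≤ i by omega)
      rw [excess_succ h0.le (by linarith), advantage,
        kernel_congr p fun j hj => ih j hj (hj.trans hi), neg_sub,
        ← gain_eq h0.ne' (by linarith) h]
      exact max_eq_right (hx _ hi)

/-- If it never hurts to continue before, the advantage of stopping is explicit. -/
theorem advantage_eq_neg_gain (h0 : 0 < p) (h2 : p ≤ 1 / 2) {n : ℕ} (hn : 4 ≤ n)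
    (hx : ∀ i < n, 0 ≤ gain p i) : advantage p n = -gain p n := by
  rw [gain_eq h0.ne' (by linarith) hn, advantage, kernel_congr p (excess_eq_gain h0 h2 hx), neg_sub]

/-- Without drift `stopGain` is nonpositive, so the recursion only adds nonnegative terms. This is
the right end of an intermediate value argument. -/
theorem gain_half_nonneg (n : ℕ) : 0 ≤ gain (1 / 2) n := by
  induction n using Nat.strong_induction_on with
  | _ n ih =>
    rcases lt_or_ge n 4 with hn | hn
    · rw [gain_of_lt hn]
    · rw [gain_eq (by norm_num) (by norm_num) hn]
      have h1 := kernel_nonneg (p := 1 / 2) (by norm_num) (by norm_num) ih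
      have h2 : stopGain (1 / 2) n ≤ 0 := by
        obtain ⟨k, s, hs⟩ := exists_stopGain_eq (show 2 ≤ n by omega)
        rw [hs _ (by norm_num)]
        have := Finset.sum_nonneg fun m (_ : m ∈ Finset.range k) =>
          mul_nonneg (cat_pos (p := 1 / 2) (by norm_num) (by norm_num) (m + 1)).le
            (runDeficit_nonneg (p := 1 / 2) (by norm_num) le_rfl (s m))
        linarith
      linarith

theorem continuousOn_gain (n : ℕ) : ContinuousOn (fun p => gain p n) (Set.Ioo 0 1) := by
  have hS : ∀ n, Continuous fun p => catSum p n := fun n =>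
    continuous_finsetSum _ fun i _ => continuous_cat i
  have h0 : ∀ p ∈ Set.Ioo (0 : ℝ) 1, p ≠ 0 := fun p hp => hp.1.ne'
  have h1 : ∀ p ∈ Set.Ioo (0 : ℝ) 1, p * (1 - p) ≠ 0 := fun p hp =>
    (mul_pos hp.1 (sub_pos.2 hp.2)).ne'
  unfold gain
  split_ifs
  · exact continuousOn_const
  · have e1 := fun k => (hS k).continuousOn (s := Set.Ioo 0 1)
    unfold evenGain
    fun_prop (disch := assumption)
  · have e1 := fun k => (hS k).continuousOn (s := Set.Ioo 0 1)
    unfold oddGain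
    fun_prop (disch := assumption)

/-- The gain increases with `p` as long as it never hurts to continue before. -/
theorem gain_mono {p' : ℝ} (h0 : 0 < p) (hpp : p ≤ p') (h2 : p' ≤ 1 / 2) {n : ℕ}
    (hx : ∀ i < n, 0 ≤ gain p i) : ∀ i ≤ n, gain p i ≤ gain p' i := by
  intro i
  induction i using Nat.strong_induction_on with
  | _ i ih =>
    intro hi
    rcases lt_or_ge i 4 with h | h
    · rw [gain_of_lt h, gain_of_lt h]
    · rw [gain_eq h0.ne' (by linarith) h, gain_eq (by linarith) (by linarith) h]
      have h3 : stopGain p' i ≤ stopGain p i := by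
        rcases hpp.eq_or_lt with rfl | hlt
        · exact le_rfl
        · exact (stopGain_lt h0 hlt h2 (by omega)).le
      exact sub_le_sub (kernel_le_kernel h0 hpp h2 (fun j hj => hx j (by omega))
        fun j hj => ih j hj (by omega)) h3

/-- If stopping is strictly better at `p'`, and continuing never hurts before, then continuing
hurts for all smaller parameters. -/
theorem gain_neg_of_le {p' : ℝ} (h0 : 0 < p) (hpp : p ≤ p') (h2 : p' ≤ 1 / 2) {n : ℕ} (hn : 4 ≤ n)
    (hx : ∀ i < n, 0 ≤ gain p' i) (hneg : gain p' n < 0) : gain p n < 0 := by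
  have h3 := advantage_eq_neg_gain (h0.trans_le hpp) h2 hn hx
  have h4 : advantage p' n ≤ advantage p n := by
    rcases hpp.eq_or_lt with rfl | hlt
    · exact le_rfl
    · exact (advantage_lt h0 hlt h2 (by omega)).le
  have h5 := advantage_le_neg_gain h0 (by linarith) hn
  linarith

end

/-! ### Increments of the explicit gains -/

section

variable {p : ℝ}

theorem oddGain_succ_sub (h0 : p ≠ 0) (h1 : p ≠ 1) (n : ℕ) :
    oddGain p (n + 1) - oddGain p n = (3 - 2 * p) * cat p (n + 2) - cat p (n + 3) / p -
      p * (1 - p) * cat p (n + 1) + (1 - 2 * p) * ((2 - (1 - p) ^ 2 / p) * cat p (n + 1) -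
        p * cat p n - (1 / p + 1 / (p * (1 - p))) * cat p (n + 2)) := by
  have hq : 1 - p ≠ 0 := sub_ne_zero.2 h1.symm
  rw [oddGain, oddGain]
  simp only [show n + 1 + 1 = n + 2 by rfl, show n + 1 + 2 = n + 3 by rfl,
    show n + 1 + 3 = n + 4 by rfl, catSum_succ p (n + 3), catSum_succ p (n + 2),
    catSum_succ p (n + 1), catSum_succ p n]
  field_simp
  ring

theorem evenGain_succ_sub (h0 : p ≠ 0) (h1 : p ≠ 1) (n : ℕ) :
    evenGain p (n + 1) - oddGain p n = -((1 - p) / p) * cat p (n + 3) +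
      (1 + (1 - p) + (1 - p) ^ 2) * cat p (n + 2) - p * (1 - p) * cat p (n + 1) +
      (1 - 2 * p) * (-(cat p (n + 3) / (p * (1 - p))) +
        (1 - (2 - p) / p - 1 / (p * (1 - p))) * cat p (n + 2) +
        (1 - (1 - p) / p + 2 * (1 - p)) * cat p (n + 1) - p * cat p n) := by
  have hq : 1 - p ≠ 0 := sub_ne_zero.2 h1.symm
  rw [evenGain, oddGain]
  simp only [show n + 1 + 1 = n + 2 by rfl, show n + 1 + 2 = n + 3 by rfl,
    show n + 1 + 3 = n + 4 by rfl, catSum_succ p (n + 3), catSum_succ p (n + 2),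
    catSum_succ p (n + 1), catSum_succ p n]
  field_simp
  ring

theorem evenGain_add_two_sub (h0 : p ≠ 0) (h1 : p ≠ 1) (n : ℕ) :
    evenGain p (n + 2) - evenGain p (n + 1) = (1 - p) * (2 - p) * cat p (n + 3) -
      (1 - p) / p * cat p (n + 4) - (1 - 2 * p) * (-2 * (1 - p) * cat p (n + 2) +
        ((2 - p) / p - 1) * cat p (n + 3) + cat p (n + 4) / (p * (1 - p))) := by
  have hq : 1 - p ≠ 0 := sub_ne_zero.2 h1.symm
  rw [evenGain, evenGain]
  simp only [show n + 1 + 1 = n + 2 by rfl, show n + 1 + 2 = n + 3 by rfl,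
    show n + 1 + 3 = n + 4 by rfl,
    show n + 2 + 3 = n + 5 by rfl, catSum_succ p (n + 4), catSum_succ p (n + 3),
    catSum_succ p (n + 2)]
  field_simp
  ring

end

section

variable {m : ℝ}

theorem cat_succ_eq (p : ℝ) (n : ℕ) :
    cat p (n + 1) = 2 * (p * (1 - p)) * (2 * n + 1) / (n + 2) * cat p n := by
  have := cat_succ p n
  field_simp
  linarith

/-- The numerator of `oddGain p (n + 1) - oddGain p n` over `cat p n`, where `p = (1 - m) / 2`. -/
noncomputable def oddStep (m x : ℝ) : ℝ :=
  (3 / 4 - 87 / 4 * m - 9 / 2 * m ^ 2 - 3 / 2 * m ^ 3 + 15 / 4 * m ^ 4 - 3 / 4 * m ^ 5) +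
  (17 / 8 - 45 * m - 32 * m ^ 2 + 15 / 4 * m ^ 3 + 95 / 8 * m ^ 4 - 11 / 4 * m ^ 5) * x +
  (9 / 8 - 129 / 4 * m - 21 * m ^ 2 + 63 / 4 * m ^ 3 + 75 / 8 * m ^ 4 - 3 * m ^ 5) * x ^ 2 +
  (-1 / 4 - 6 * m - 5 / 2 * m ^ 2 + 9 / 2 * m ^ 3 + 5 / 4 * m ^ 4 - m ^ 5) * x ^ 3

/-- Ratios of consecutive Catalan weights are rational in `n`, so after clearing denominators the
increment is a cubic in `n`. The parameter `m = 1 - 2 p` is the downward drift. -/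
theorem oddGain_succ_sub_mul (h0 : m ≠ -1) (h1 : m ≠ 1) (n : ℕ) :
    (n + 2) * (n + 3) * (n + 4) * (oddGain ((1 - m) / 2) (n + 1) - oddGain ((1 - m) / 2) n) =
      cat ((1 - m) / 2) n * oddStep m n := by
  have hp : 1 - m ≠ 0 := sub_ne_zero.2 h1.symm
  have hq : 1 + m ≠ 0 := fun h => h0 (by linarith)
  have hp' : (1 - m) / 2 ≠ 0 := div_ne_zero hp two_ne_zero
  have e : 1 - (1 - m) / 2 = (1 + m) / 2 := by ring
  rw [oddGain_succ_sub hp' (fun h => h0 (by linarith)), cat_succ_eq _ (n + 2),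
    cat_succ_eq _ (n + 1), cat_succ_eq _ n, e, oddStep]
  push_cast
  field_simp
  ring

/-- The numerator of `evenGain p (n + 1) - oddGain p n` over `cat p n`, where `p = (1 - m) / 2`. -/
noncomputable def evenStep (m x : ℝ) : ℝ :=
  (15 / 8 - 129 / 4 * m - 87 / 8 * m ^ 2 + 21 / 2 * m ^ 3 + 81 / 8 * m ^ 4 - 9 / 4 * m ^ 5 -
    9 / 8 * m ^ 6) +
  (91 / 16 - 303 / 4 * m - 839 / 16 * m ^ 2 + 40 * m ^ 3 + 517 / 16 * m ^ 4 - 33 / 4 * m ^ 5 -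
    57 / 16 * m ^ 6) * x +
  (33 / 8 - 54 * m - 153 / 4 * m ^ 2 + 87 / 2 * m ^ 3 + 213 / 8 * m ^ 4 - 9 * m ^ 5 -
    3 * m ^ 6) * x ^ 2 +
  (1 / 2 - 21 / 2 * m - 25 / 4 * m ^ 2 + 11 * m ^ 3 + 5 * m ^ 4 - 3 * m ^ 5 -
    3 / 4 * m ^ 6) * x ^ 3

theorem evenGain_succ_sub_mul (h0 : m ≠ -1) (h1 : m ≠ 1) (n : ℕ) :
    (n + 2) * (n + 3) * (n + 4) * (evenGain ((1 - m) / 2) (n + 1) - oddGain ((1 - m) / 2) n) =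
      cat ((1 - m) / 2) n * evenStep m n := by
  have hp : 1 - m ≠ 0 := sub_ne_zero.2 h1.symm
  have hq : 1 + m ≠ 0 := fun h => h0 (by linarith)
  have hp' : (1 - m) / 2 ≠ 0 := div_ne_zero hp two_ne_zero
  have e : 1 - (1 - m) / 2 = (1 + m) / 2 := by ring
  rw [evenGain_succ_sub hp' (fun h => h0 (by linarith)), cat_succ_eq _ (n + 2),
    cat_succ_eq _ (n + 1), cat_succ_eq _ n, e, evenStep]
  push_cast
  field_simp
  ring

/-- The numerator of `evenGain p (n + 2) - oddGain p n` over `cat p n`, where `p = (1 - m) / 2`. -/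
noncomputable def evenJump (m x : ℝ) : ℝ :=
  (315 / 32 - 195 * m - 165 / 2 * m ^ 2 + 525 / 4 * m ^ 3 + 1755 / 16 * m ^ 4 -
    135 / 2 * m ^ 5 - 165 / 4 * m ^ 6 + 45 / 4 * m ^ 7 + 135 / 32 * m ^ 8) +
  (1001 / 32 - 4215 / 8 * m - 5857 / 16 * m ^ 2 + 3859 / 8 * m ^ 3 + 2953 / 8 * m ^ 4 -
    1917 / 8 * m ^ 5 - 2219 / 16 * m ^ 6 + 321 / 8 * m ^ 7 + 459 / 32 * m ^ 8) * x +
  (26 - 1857 / 4 * m - 5303 / 16 * m ^ 2 + 2155 / 4 * m ^ 3 + 5701 / 16 * m ^ 4 -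
    1041 / 4 * m ^ 5 - 2173 / 16 * m ^ 6 + 177 / 4 * m ^ 7 + 231 / 16 * m ^ 8) * x ^ 2 +
  (23 / 4 - 153 * m - 199 / 2 * m ^ 2 + 211 * m ^ 3 + 959 / 8 * m ^ 4 - 219 / 2 * m ^ 5 -
    199 / 4 * m ^ 6 + 39 / 2 * m ^ 7 + 45 / 8 * m ^ 8) * x ^ 3 +
  (1 / 4 - 33 / 2 * m - 37 / 4 * m ^ 2 + 26 * m ^ 3 + 25 / 2 * m ^ 4 - 15 * m ^ 5 -
    23 / 4 * m ^ 6 + 3 * m ^ 7 + 3 / 4 * m ^ 8) * x ^ 4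

theorem evenGain_add_two_sub_mul (h0 : m ≠ -1) (h1 : m ≠ 1) (n : ℕ) :
    (n + 2) * (n + 3) * (n + 4) * (n + 5) *
        (evenGain ((1 - m) / 2) (n + 2) - oddGain ((1 - m) / 2) n) =
      cat ((1 - m) / 2) n * evenJump m n := by
  have hp : 1 - m ≠ 0 := sub_ne_zero.2 h1.symm
  have hq : 1 + m ≠ 0 := fun h => h0 (by linarith)
  have hp' : (1 - m) / 2 ≠ 0 := div_ne_zero hp two_ne_zero
  have e : 1 - (1 - m) / 2 = (1 + m) / 2 := by ring
  have h := evenGain_succ_sub_mul h0 h1 n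
  have h2 : (n + 2) * (n + 3) * (n + 4) * (n + 5) *
      (evenGain ((1 - m) / 2) (n + 2) - evenGain ((1 - m) / 2) (n + 1)) =
      cat ((1 - m) / 2) n * (evenJump m n - (n + 5) * evenStep m n) := by
    rw [evenGain_add_two_sub hp' (fun h => h0 (by linarith)), cat_succ_eq _ (n + 3),
      cat_succ_eq _ (n + 2), cat_succ_eq _ (n + 1), cat_succ_eq _ n, e, evenStep, evenJump]
    push_cast
    field_simp
    ring
  linear_combination h2 + (n + 5 : ℝ) * h

/-- The denominators (x+2)(x+3)(x+4) at `x` and `x + 1` have ratio (x+2)/(x+5). So the increments of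
`oddGain`, divided by `cat p n`, decrease in `n`: once the odd gains fall, they keep falling. -/
theorem oddStep_decreasing (h0 : 0 ≤ m) (h1 : m ≤ 1 / 16) {x : ℝ} (hx : 1 ≤ x) :
    (x + 2) * oddStep m (x + 1) ≤ (x + 5) * oddStep m x := by
  -- Expanded about `x = 1` all coefficients are nonnegative; at `x = 0`, `m = 0` the inequality
  -- fails.
  obtain ⟨y, rfl⟩ : ∃ y, x = y + 1 := ⟨x - 1, by ring⟩
  have hy : 0 ≤ y := by linarith
  have h2 : 0 ≤ 1 / 16 - m := by linarith
  have e : (y + 1 + 5) * oddStep m (y + 1) - (y + 1 + 2) * oddStep m (y + 1 + 1) =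
      (945 / 4 * m + 315 / 2 * m ^ 2 - 180 * m ^ 3 - 135 / 2 * m ^ 4 + 135 / 4 * m ^ 5) +
      (57 / 8 + 627 / 4 * m + 123 / 2 * m ^ 2 - 609 / 4 * m ^ 3 - 285 / 8 * m ^ 4 +
        57 / 2 * m ^ 5) * y +
      (27 / 8 + 87 / 4 * m + 3 / 2 * m ^ 2 - 99 / 4 * m ^ 3 - 15 / 8 * m ^ 4 + 6 * m ^ 5) *
        y ^ 2 := by
    simp only [oddStep]
    ring
  have p2 := pow_nonneg h0 2
  have p3 : m ^ 3 ≤ m := pow_le_of_le_one h0 (by linarith) (by norm_num)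
  have p3' : m ^ 3 ≤ m * (1 / 256) := by nlinarith
  have p4 : m ^ 4 ≤ m * (1 / 256) := by nlinarith [pow_nonneg h0 3]
  have p5 := pow_nonneg h0 5
  have c0 : 0 ≤ 945 / 4 * m + 315 / 2 * m ^ 2 - 180 * m ^ 3 - 135 / 2 * m ^ 4 + 135 / 4 * m ^ 5 := by
    linarith
  have c1 : 0 ≤ 57 / 8 + 627 / 4 * m + 123 / 2 * m ^ 2 - 609 / 4 * m ^ 3 - 285 / 8 * m ^ 4 +
      57 / 2 * m ^ 5 := by
    linarith
  have c2 : 0 ≤ 27 / 8 + 87 / 4 * m + 3 / 2 * m ^ 2 - 99 / 4 * m ^ 3 - 15 / 8 * m ^ 4 +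
      6 * m ^ 5 := by
    linarith
  have := add_nonneg (add_nonneg c0 (mul_nonneg c1 hy)) (mul_nonneg c2 (pow_nonneg hy 2))
  linarith

theorem evenStep_nonneg (h0 : 0 ≤ m) (h1 : m ≤ 1 / 25) {x : ℝ} (hx : 0 ≤ x) :
    0 ≤ evenStep m x := by
  have p2 : m ^ 2 ≤ m * (1 / 25) := by nlinarith
  have p3 := pow_nonneg h0 3
  have p4 := pow_nonneg h0 4
  have p5 : m ^ 5 ≤ m ^ 4 := pow_le_pow_of_le_one h0 (by linarith) (by norm_num)
  have p6 : m ^ 6 ≤ m ^ 4 := pow_le_pow_of_le_one h0 (by linarith) (by norm_num)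
  rw [evenStep]
  refine add_nonneg (add_nonneg (add_nonneg ?_ (mul_nonneg ?_ hx))
    (mul_nonneg ?_ (pow_nonneg hx 2))) (mul_nonneg ?_ (pow_nonneg hx 3)) <;> linarith

/-- A lower bound for `evenJump` that is linear in `m`. -/
theorem le_evenJump (h0 : 0 ≤ m) (h1 : m ≤ 1 / 30) {x : ℝ} (hx : 0 ≤ x) :
    (315 / 32 - 198 * m) + (1001 / 32 - 540 * m) * x + (26 - 476 * m) * x ^ 2 +
      (23 / 4 - 157 * m) * x ^ 3 + (1 / 4 - 17 * m) * x ^ 4 ≤ evenJump m x := by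
  have p2 : m ^ 2 ≤ m * (1 / 30) := by nlinarith
  have p3 := pow_nonneg h0 3
  have p4 := pow_nonneg h0 4
  have p5 : m ^ 5 ≤ m ^ 3 := pow_le_pow_of_le_one h0 (by linarith) (by norm_num)
  have p6 : m ^ 6 ≤ m ^ 4 := pow_le_pow_of_le_one h0 (by linarith) (by norm_num)
  have p7 := pow_nonneg h0 7
  have p8 := pow_nonneg h0 8
  rw [evenJump]
  refine add_le_add (add_le_add (add_le_add (add_le_add ?_ (mul_le_mul_of_nonneg_right ?_ hx))
    (mul_le_mul_of_nonneg_right ?_ (pow_nonneg hx 2)))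
    (mul_le_mul_of_nonneg_right ?_ (pow_nonneg hx 3)))
    (mul_le_mul_of_nonneg_right ?_ (pow_nonneg hx 4)) <;> linarith

end

/-! ### Signs of the explicit gains -/

section

variable {p : ℝ}

theorem cat_eq_descFactorial (p : ℝ) (n : ℕ) : cat p n =
    (((2 * n).descFactorial n / n.factorial / (n + 1) : ℕ) : ℝ) * (p * (1 - p)) ^ n := by
  rw [cat, catalan_eq_centralBinom_div, Nat.centralBinom,
    Nat.choose_eq_descFactorial_div_factorial]

theorem oddGain_succ_le_iff (h0 : 0 < p) (h1 : p < 1) (n : ℕ) :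
    oddGain p (n + 1) ≤ oddGain p n ↔ oddStep (1 - 2 * p) n ≤ 0 := by
  obtain ⟨m, rfl⟩ : ∃ m, p = (1 - m) / 2 := ⟨1 - 2 * p, by ring⟩
  have h := oddGain_succ_sub_mul (m := m) (fun h => by linarith) (fun h => by linarith) n
  have hc := cat_pos h0 h1 n
  have hn : (0 : ℝ) < (n + 2) * (n + 3) * (n + 4) := by positivity
  rw [show 1 - 2 * ((1 - m) / 2) = m by ring, ← sub_nonpos]
  constructor <;> intro h'
  · by_contra! hlt
    linarith [mul_pos hc hlt, mul_nonpos_of_nonneg_of_nonpos hn.le h']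
  · by_contra! hlt
    linarith [mul_pos hn hlt, mul_nonpos_of_nonneg_of_nonpos hc.le h']

theorem oddGain_le_of_succ_le (h1 : 15 / 32 ≤ p) (h2 : p ≤ 1 / 2) {j n : ℕ} (hj : 1 ≤ j)
    (h : oddGain p (j + 1) ≤ oddGain p j) (hn : j ≤ n) :
    oddGain p (n + 1) ≤ oddGain p n ∧ oddGain p n ≤ oddGain p j := by
  induction n, hn using Nat.le_induction with
  | base => exact ⟨h, le_rfl⟩
  | succ n hn ih =>
    refine ⟨?_, ih.1.trans ih.2⟩
    rw [oddGain_succ_le_iff (by linarith) (by linarith)] at ih ⊢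
    have hn1 : (1 : ℝ) ≤ n := by exact_mod_cast hj.trans hn
    have h3 := oddStep_decreasing (m := 1 - 2 * p) (by linarith) (by linarith) hn1
    have h4 : (n + 5 : ℝ) * oddStep (1 - 2 * p) n ≤ 0 :=
      mul_nonpos_of_nonneg_of_nonpos (by linarith) ih.1
    push_cast
    by_contra! hlt
    linarith [mul_pos (show (0 : ℝ) < n + 2 by linarith) hlt]

/-- A unimodal sequence is bounded below by its end values. -/
theorem oddGain_nonneg_of_ends (h1 : 15 / 32 ≤ p) (h2 : p ≤ 1 / 2) {n : ℕ}
    (ho : 0 ≤ oddGain p 1) (hn : 0 ≤ oddGain p n) {k : ℕ} (hk : 1 ≤ k) (hkn : k ≤ n) :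
    0 ≤ oddGain p k := by
  by_cases h : oddGain p (k + 1) ≤ oddGain p k
  · exact hn.trans (oddGain_le_of_succ_le h1 h2 hk h hkn).2
  · have : ∀ i, 1 ≤ i → i ≤ k → oddGain p 1 ≤ oddGain p i := by
      intro i hi
      induction i, hi using Nat.le_induction with
      | base => exact fun _ => le_rfl
      | succ i hi ih =>
        intro hik
        refine (ih (by omega)).trans ?_
        by_contra! hlt
        exact h (oddGain_le_of_succ_le h1 h2 hi hlt.le (by omega)).1
    exact ho.trans (this k hk le_rfl)

theorem oddGain_le_evenGain_succ (h1 : 12 / 25 ≤ p) (h2 : p ≤ 1 / 2) (n : ℕ) :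
    oddGain p n ≤ evenGain p (n + 1) := by
  obtain ⟨m, rfl⟩ : ∃ m, p = (1 - m) / 2 := ⟨1 - 2 * p, by ring⟩
  have h := evenGain_succ_sub_mul (m := m) (fun h => by linarith) (fun h => by linarith) n
  have hc := cat_pos (p := (1 - m) / 2) (by linarith) (by linarith) n
  have hs := evenStep_nonneg (m := m) (by linarith) (by linarith) n.cast_nonneg
  by_contra! hlt
  have hn : (0 : ℝ) < (n + 2) * (n + 3) * (n + 4) := by positivity
  linarith [mul_pos hn (sub_pos.2 hlt), mul_nonneg hc.le hs]

theorem oddGain_le_evenGain_add_two (h0 : 0 < p) (h2 : p ≤ 1 / 2) {n : ℕ}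
    (hs : 0 ≤ evenJump (1 - 2 * p) n) : oddGain p n ≤ evenGain p (n + 2) := by
  obtain ⟨m, rfl⟩ : ∃ m, p = (1 - m) / 2 := ⟨1 - 2 * p, by ring⟩
  rw [show 1 - 2 * ((1 - m) / 2) = m by ring] at hs
  have h := evenGain_add_two_sub_mul (m := m) (fun h => by linarith) (fun h => by linarith) n
  have hc := cat_pos (p := (1 - m) / 2) (by linarith) (by linarith) n
  by_contra! hlt
  have hn : (0 : ℝ) < (n + 2) * (n + 3) * (n + 4) * (n + 5) := by positivity
  linarith [mul_pos hn (sub_pos.2 hlt), mul_nonneg hc.le hs]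

theorem gain_nonneg_base {i : ℕ} (hi : i < 9) : 0 ≤ gain (29 / 60) i := by
  rcases lt_or_ge i 4 with h | h
  · rw [gain_of_lt h]
  · have e0 := gain_even (29 / 60) 0
    have e1 := gain_even (29 / 60) 1
    have e2 := gain_even (29 / 60) 2
    have o1 := gain_odd (p := 29 / 60) (by norm_num) (by norm_num) 1
    have o2 := gain_odd (p := 29 / 60) (by norm_num) (by norm_num) 2
    norm_num only at e0 e1 e2 o1 o2
    interval_cases i <;> simp only [e0, e1, e2, o1, o2] <;>
      norm_num [oddGain, evenGain, catSum, cat_eq_descFactorial, Finset.sum_range_succ]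

/-- The states up to 8 are settled at 29/60 and carried to `p` by `gain_mono`. Beyond them
unimodality handles the odd gains, and each even gain dominates an earlier odd one. -/
theorem gain_nonneg_of_oddGain_nonneg (h1 : 29 / 60 ≤ p) (h2 : p ≤ 1 / 2) {n : ℕ}
    (hn : 0 ≤ oddGain p n) {i : ℕ} (hi : i ≤ 2 * n + 4) : 0 ≤ gain p i := by
  have hb : ∀ i < 9, 0 ≤ gain p i := fun i hi =>
    (gain_nonneg_base hi).trans (gain_mono (n := 8) (by norm_num) h1 h2
      (fun j hj => gain_nonneg_base (by omega)) i (by omega))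
  have h0 : p ≠ 0 := by linarith
  have h1' : p ≠ 1 := by linarith
  have ho : ∀ k ≤ n, 0 ≤ oddGain p k := by
    intro k hk
    rcases Nat.eq_zero_or_pos k with rfl | hk0
    · rw [oddGain_zero h0 h1']
    · refine oddGain_nonneg_of_ends (by linarith) h2 ?_ hn hk0 hk
      rw [← gain_odd h0 h1']
      exact hb _ (by norm_num)
  rcases lt_or_ge i 5 with h | h
  · exact hb i (by omega)
  · rcases Nat.even_or_odd' i with ⟨k, rfl | rfl⟩
    · obtain ⟨k, rfl⟩ := Nat.exists_eq_add_of_le' (show 3 ≤ k by omega)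
      rw [show 2 * (k + 3) = 2 * (k + 1) + 4 by ring, gain_even]
      exact (ho k (by omega)).trans (oddGain_le_evenGain_succ (by linarith) h2 k)
    · obtain ⟨k, rfl⟩ := Nat.exists_eq_add_of_le' (show 1 ≤ k by omega)
      rw [show 2 * (k + 1) + 1 = 2 * k + 3 by ring, gain_odd h0 h1']
      exact ho k (by omega)

/-- Below p_n the advantage would be strictly positive, yet it is at most minus the gain. -/
theorem criticalValue_le_of_gain_nonneg (h0 : 0 < p) {n : ℕ} (hn : 4 ≤ n)
    (h : 0 ≤ gain p n) : criticalValue n ≤ p := by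
  obtain ⟨hc, hc2, hs⟩ := criticalValue_spec (n := n) (by omega)
  by_contra! hlt
  have h3 := (hs _ hc (by linarith)).2 le_rfl
  have h4 := advantage_lt h0 hlt hc2 (n := n) (by omega)
  have h5 := advantage_le_neg_gain h0 (by linarith) hn
  linarith

/-- At 29/60 the gain in (9, 1) is negative while all earlier gains are nonnegative. Below 29/60 it
is still negative, and the later odd gains only fall further. -/
theorem le_of_oddGain_nonneg_aux (h0 : 0 < p) (h2 : p ≤ 1 / 2) {n : ℕ} (hn : 3 ≤ n)
    (h : 0 ≤ oddGain p n) : 29 / 60 ≤ p := by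
  have h4 : 15 / 32 ≤ p := by
    -- The minimality of p_4 > 15/32 brings `p` into the range of `oddStep_decreasing`.
    have h5 := criticalValue_le_of_gain_nonneg (n := 2 * n + 3) h0 (by omega)
      (by rwa [gain_odd h0.ne' (by linarith)])
    have h6 := criticalValue_four_le (n := 2 * n + 3) (by omega)
    have h7 := criticalValue_four_bounds.1
    norm_num at h7
    linarith
  by_contra! hlt
  have hstep : oddGain p (2 + 1) ≤ oddGain p 2 := by
    rw [oddGain_succ_le_iff h0 (by linarith)]
    obtain ⟨m, hm⟩ : ∃ m, m = 1 - 2 * p := ⟨_, rfl⟩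
    have hm0 : 0 ≤ m := by linarith
    have hm1 : m ≤ 1 / 16 := by linarith
    have p3 : m ^ 3 ≤ m ^ 2 * (1 / 16) := by
      rw [pow_succ]
      exact mul_le_mul_of_nonneg_left hm1 (sq_nonneg m)
    have p4 : m ^ 4 ≤ m ^ 2 := pow_le_pow_of_le_one hm0 (by linarith) (by norm_num)
    have p5 := pow_nonneg hm0 5
    have p2 := sq_nonneg m
    rw [← hm, oddStep]
    push_cast
    linarith
  have h3 : 0 ≤ oddGain p 3 :=
    h.trans (oddGain_le_of_succ_le h4 h2 (j := 3) (by norm_num)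
      (oddGain_le_of_succ_le h4 h2 (by norm_num) hstep (by norm_num)).1 hn).2
  have h5 : gain p 9 < 0 := by
    refine gain_neg_of_le h0 hlt.le (by norm_num) (by norm_num) (fun i hi => gain_nonneg_base hi) ?_
    rw [show 9 = 2 * 3 + 3 by norm_num, gain_odd (by norm_num) (by norm_num)]
    norm_num [oddGain, catSum, cat_eq_descFactorial, Finset.sum_range_succ]
  rw [show 9 = 2 * 3 + 3 by norm_num, gain_odd h0.ne' (by linarith)] at h5
  exact h3.not_gt h5

/-- A parameter at which continuing does not hurt in the state `(2 n + 3, 1)` exceeds every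
parameter at which it does hurt in an earlier state `(2 k + 3, 1)`. -/
theorem le_of_oddGain_nonneg (h0 : 0 < p) (h2 : p ≤ 1 / 2) {n k : ℕ} (hn : 3 ≤ n) (hk : k ≤ n)
    (h : 0 ≤ oddGain p n) {p' : ℝ} (h2' : p' ≤ 1 / 2) (hneg : oddGain p' k < 0) : p' ≤ p := by
  have h1 := le_of_oddGain_nonneg_aux h0 h2 hn h
  by_contra! hlt
  have h3 := gain_mono h0 hlt.le h2' (n := 2 * k + 3)
    (fun i hi => gain_nonneg_of_oddGain_nonneg h1 h2 h (by omega)) _ le_rfl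
  have h4 : 0 ≤ gain p (2 * k + 3) := gain_nonneg_of_oddGain_nonneg h1 h2 h (by omega)
  rw [gain_odd (by linarith) (by linarith) (p := p')] at h3
  linarith

/-- The leading coefficient `1 / 4 - 17 * m` of the lower bound needs `m ≤ 1 / 68`. For small `n`
lower-order terms compensate a larger `m`; for larger `n` the hypothesis itself forces `p` closer to
1/2. -/
theorem evenJump_nonneg (h0 : 0 < p) (h2 : p ≤ 1 / 2) {n : ℕ} (hn : 3 ≤ n)
    (h : 0 ≤ oddGain p n) : 0 ≤ evenJump (1 - 2 * p) n := by
  have hm : 0 ≤ 1 - 2 * p := by linarith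
  have h1 := le_of_oddGain_nonneg_aux h0 h2 hn h
  refine le_trans ?_ (le_evenJump hm (by linarith) n.cast_nonneg)
  rcases lt_or_ge n 8 with h8 | h8
  · interval_cases n <;> norm_num <;> linarith
  rcases lt_or_ge n 16 with h16 | h16
  -- The witnesses 39/80, 53/108 and 67/136 correspond to `m` = 1/40, 1/54 and 1/68; at them the
  -- gains with index 8, 16 and 26 are still negative.
  · have := le_of_oddGain_nonneg h0 h2 hn h8 h (p' := 39 / 80) (by norm_num)
      (by norm_num [oddGain, catSum, cat_eq_descFactorial, Finset.sum_range_succ])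
    interval_cases n <;> norm_num <;> linarith
  rcases lt_or_ge n 26 with h26 | h26
  · have := le_of_oddGain_nonneg h0 h2 hn h16 h (p' := 53 / 108) (by norm_num)
      (by norm_num [oddGain, catSum, cat_eq_descFactorial, Finset.sum_range_succ])
    interval_cases n <;> norm_num <;> linarith
  · have := le_of_oddGain_nonneg h0 h2 hn h26 h (p' := 67 / 136) (by norm_num)
      (by norm_num [oddGain, catSum, cat_eq_descFactorial, Finset.sum_range_succ])
    have hx : (0 : ℝ) ≤ n := n.cast_nonneg
    refine add_nonneg (add_nonneg (add_nonneg (add_nonneg ?_ (mul_nonneg ?_ hx))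
      (mul_nonneg ?_ (pow_nonneg hx 2))) (mul_nonneg ?_ (pow_nonneg hx 3)))
      (mul_nonneg ?_ (pow_nonneg hx 4)) <;> linarith

/-! ### Comparison of critical values -/

theorem criticalValue_le_of_oddGain {n k : ℕ} (hn : 3 ≤ n) (hk : 4 ≤ k)
    (h : ∀ p, 0 < p → p ≤ 1 / 2 → 0 ≤ oddGain p n → 0 ≤ gain p k) :
    criticalValue k ≤ criticalValue (2 * n + 3) := by
  obtain ⟨hc, -, hs⟩ := criticalValue_spec (n := 2 * n + 3) (by omega)
  have hk2 := (criticalValue_spec (n := k) (by omega)).2.1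
  by_contra! hlt
  obtain ⟨p, hp, hp'⟩ := exists_between hlt
  have h0 : 0 < p := hc.trans hp
  rcases le_or_gt 0 (oddGain p n) with ho | ho
  · exact (criticalValue_le_of_gain_nonneg h0 hk
      (h p h0 (by linarith) ho)).not_gt hp'
  · have hg : gain p (2 * n + 3) < 0 := by rwa [gain_odd h0.ne' (by linarith)]
    -- At a zero `x` of the gain all earlier gains are nonnegative, so the advantage is exactly 0
    -- and `x` cannot exceed the critical value, although `x ≥ p`.
    obtain ⟨x, hx, hx0⟩ := intermediate_value_Icc (show p ≤ 1 / 2 by linarith)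
      ((continuousOn_gain (2 * n + 3)).mono fun y hy =>
        ⟨h0.trans_le hy.1, hy.2.trans_lt (by norm_num)⟩) ⟨hg.le, gain_half_nonneg _⟩
    have hx00 : 0 < x := h0.trans_le hx.1
    have ho' : oddGain x n = 0 := by rwa [← gain_odd hx00.ne' (by linarith [hx.2])]
    have hx1 := le_of_oddGain_nonneg_aux hx00 hx.2 hn ho'.ge
    have hD := advantage_eq_neg_gain hx00 hx.2 (n := 2 * n + 3) (by omega)
      fun i hi => gain_nonneg_of_oddGain_nonneg hx1 hx.2 ho'.ge (by omega)
    have := (hs x hx00 (by linarith [hx.2])).1 (by rw [hD]; exact (neg_eq_zero.2 hx0).ge)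
    linarith [hx.1]

theorem criticalValue_even_le {n : ℕ} (hn : 3 ≤ n) :
    criticalValue (2 * n + 6) ≤ criticalValue (2 * n + 3) :=
  criticalValue_le_of_oddGain hn (by omega) fun p h0 h2 h => by
    rw [show 2 * n + 6 = 2 * (n + 1) + 4 by ring, gain_even]
    exact h.trans (oddGain_le_evenGain_succ
      (by linarith [le_of_oddGain_nonneg_aux h0 h2 hn h]) h2 n)

theorem criticalValue_even_le' {n : ℕ} (hn : 3 ≤ n) :
    criticalValue (2 * n + 8) ≤ criticalValue (2 * n + 3) :=
  criticalValue_le_of_oddGain hn (by omega) fun p h0 h2 h => by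
    rw [show 2 * n + 8 = 2 * (n + 2) + 4 by ring, gain_even]
    exact h.trans (oddGain_le_evenGain_add_two h0 h2 (evenJump_nonneg h0 h2 hn h))

/-! ### Remaining small states -/

theorem half_le_criticalValue_three : 1 / 2 ≤ criticalValue 3 := by
  refine ((criticalValue_spec (by norm_num)).2.2 _ (by norm_num) (by norm_num)).1 ?_
  have h := stopGain_odd_eq (p := 1 / 2) (by norm_num) 0
  norm_num [stopGain_two] at h
  rw [advantage, kernel_congr (1 / 2) (y := fun _ => 0) fun i hi =>
    excess_eq_zero_of_lt_four (by norm_num) le_rfl (by omega), h]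
  simp [kernel, runSum, returnSum]

/-- At 0.482 the explicit rule does not gain in (5, 1), so `excess p 5 = 0` has to replace `gain p
5` in the recursion for (7, 1). -/
theorem le_criticalValue_five_seven :
    482 / 1000 ≤ criticalValue 5 ∧ 482 / 1000 ≤ criticalValue 7 := by
  set p : ℝ := 482 / 1000 with hp
  have h0 : 0 < p := by norm_num [p]
  have h2 : p ≤ 1 / 2 := by norm_num [p]
  have h1 : p < 1 := by norm_num [p]
  have hg : ∀ i < 5, 0 ≤ gain p i := by
    intro i hi
    rcases lt_or_ge i 4 with h | h
    · rw [gain_of_lt h]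
    · obtain rfl : i = 4 := by omega
      rw [show 4 = 2 * 0 + 4 by norm_num, gain_even, evenGain_zero h0.ne' h1.ne]
      norm_num [p]
  have g5 : gain p 5 = oddGain p 1 := gain_odd h0.ne' h1.ne 1
  have g7 : gain p 7 = oddGain p 2 := gain_odd h0.ne' h1.ne 2
  have h5 : advantage p 5 = -gain p 5 := advantage_eq_neg_gain h0 h2 (by norm_num) hg
  have a5 : 0 ≤ advantage p 5 := by
    rw [h5, g5]
    norm_num [p, oddGain, catSum, cat_eq_descFactorial, Finset.sum_range_succ]
  have hw : ∀ i < 5, excess p i = gain p i := excess_eq_gain h0 h2 hg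
  have w5 : excess p 5 = 0 := by
    rw [excess_succ h0.le h1.le, max_eq_left (by linarith)]
  -- Five remaining steps are reached by up-down or down-up, four only by up-up-down.
  have hK : ∀ x : ℕ → ℝ, (∀ i < 4, x i = 0) →
      kernel p x 7 = p * (p * (1 - p)) * x 4 + 2 * (p * (1 - p)) * x 5 := fun x hx => by
    simp [kernel, runSum, returnSum, Finset.sum_range_succ, hx]
    ring
  have a7 : 0 ≤ advantage p 7 := by
    have e := gain_eq h0.ne' h1.ne (n := 7) (by norm_num)
    rw [hK _ fun i hi => gain_of_lt hi, g5, g7] at e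
    rw [advantage, hK _ fun i hi => excess_eq_zero_of_lt_four h0 h2 hi, w5, hw 4 (by norm_num)]
    have : 0 ≤ 2 * (p * (1 - p)) * oddGain p 1 - oddGain p 2 := by
      norm_num [p, oddGain, catSum, cat_eq_descFactorial, Finset.sum_range_succ]
    linarith
  exact ⟨((criticalValue_spec (by norm_num)).2.2 _ h0 h1).1 a5,
    ((criticalValue_spec (by norm_num)).2.2 _ h0 h1).1 a7⟩

theorem criticalValue_le_of_small {k : ℕ} (h1 : 2 ≤ k) (h2 : k ≤ 4) :
    criticalValue (2 * k + 4) ≤ 482 / 1000 := by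
  refine criticalValue_le_of_gain_nonneg (by norm_num) (by omega) ?_
  rw [gain_even]
  interval_cases k <;>
    norm_num [evenGain, catSum, cat_eq_descFactorial, Finset.sum_range_succ]

end

end BernoulliWalk

/-- The numbers `criticalValue n`, `n ≥ 1`, are the critical values for stopping in state `(n, 1)`,
and they have the properties (a), (b), (c). -/
theorem theorem1p1 :
    (∀ n : ℕ, 1 ≤ n → ∀ p : unitInterval, 0 < (p : ℝ) → (p : ℝ) < 1 →
      (BernoulliWalk.OptimalToStop p n 1 ↔ (p : ℝ) ≤ BernoulliWalk.criticalValue n)) ∧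
    ((∀ n : ℕ, 1 ≤ n → BernoulliWalk.criticalValue 4 ≤ BernoulliWalk.criticalValue n) ∧
      (0.468989 : ℝ) ≤ BernoulliWalk.criticalValue 4 ∧
      BernoulliWalk.criticalValue 4 < (0.468990 : ℝ)) ∧
    (∀ n : ℕ, BernoulliWalk.criticalValue (2 * n + 4) ≤ BernoulliWalk.criticalValue (2 * n + 1)) ∧
    (∀ n : ℕ, 3 ≤ n →
      BernoulliWalk.criticalValue (2 * n + 6) ≤ BernoulliWalk.criticalValue (2 * n + 1)) := by
  refine ⟨fun n hn p h0 h1 => BernoulliWalk.optimalToStop_iff_le_criticalValue hn h0 h1,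
    ⟨fun n hn => BernoulliWalk.criticalValue_four_le hn,
      BernoulliWalk.criticalValue_four_bounds⟩, fun n => ?_, fun n hn => ?_⟩
  · obtain ⟨h5, h7⟩ := BernoulliWalk.le_criticalValue_five_seven
    -- The general comparison starts at 2n+1 = 9. Before that: p_4 is minimal, p_6 ≤ 1/2 ≤ p_3, and
    -- 0.482 separates p_8 from p_5 and p_10 from p_7.
    rcases lt_or_ge n 4 with h | h
    · interval_cases n
      · exact BernoulliWalk.criticalValue_four_le le_rfl
      · exact (BernoulliWalk.criticalValue_spec (by norm_num)).2.1.trans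
          BernoulliWalk.half_le_criticalValue_three
      · exact (BernoulliWalk.criticalValue_le_of_small le_rfl (by norm_num)).trans h5
      · exact (BernoulliWalk.criticalValue_le_of_small (by norm_num) (by norm_num)).trans h7
    · obtain ⟨n, rfl⟩ := Nat.exists_eq_add_of_le' (show 1 ≤ n by omega)
      exact BernoulliWalk.criticalValue_even_le (n := n) (by omega)
  -- Again 2n+1 = 7 is exceptional: 0.482 separates p_12 from p_7.
  · rcases hn.eq_or_lt with rfl | h
    · exact (BernoulliWalk.criticalValue_le_of_small (k := 4) (by norm_num) le_rfl).trans
        BernoulliWalk.le_criticalValue_five_seven.2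
    · obtain ⟨n, rfl⟩ := Nat.exists_eq_add_of_le' (show 1 ≤ n by omega)
      exact BernoulliWalk.criticalValue_even_le' (n := n) (by omega)
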